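/- **Theorem (Noninterference for State and Exceptions).** *Labels.* Let $(\mathcal L,\sqsubseteq)$ be a preorder with a top element in which any two labels have a least upper bound $\sqcup$. Fix labels $\ell_{\mathsf{State}},\ell_{\mathsf{Exn}}\in\mathcal L$. *Syntax.* Types are $\tau ::= \mathsf{unit}\mid \tau_1+\tau_2\mid\tau_1\times\tau_2\mid\tau_1\xrightarrow{pc}\tau_2\mid \mathsf L_\ell(\tau)$ with $pc,\ell\in\mathcal L$. Fix a type $\sigma$ (of the single state cell). Expressions are $$e ::= x\mid ()\mid\lambda x{:}\tau.\,e\mid e_1\,e_2\mid\langle e_1,e_2\rangle\mid\pi_i(e)\mid\mathsf{inl}(e)\mid\mathsf{inr}(e)\mid(\mathsf{match}\ e\ \mathsf{with}\ \mathsf{inl}(x)\Rightarrow e_1\mid\mathsf{inr}(y)\Rightarrow e_2)\mid\mathsf{label}_\ell(e)\mid\mathsf{unlabel}\ e_1\ \mathsf{as}\ x\ \mathsf{in}\ e_2\mid\mathsf{read}\mid\mathsf{write}(e)\mid\mathsf{throw}\mid\mathsf{try}\ e_1\ \mathsf{catch}\ e_2,$$ and values are $v ::= ()\mid\mathsf{inl}(v)\mid\mathsf{inr}(v)\mid\langle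 v_1,v_2\rangle\mid\lambda x{:}\tau.\,e\mid\mathsf{label}_\ell(v)$. *Protection.* $\ell\triangleleft\tau$ is the least relation such that: $\ell\triangleleft\mathsf L_{\ell'}(\tau)$ if $\ell\sqsubseteq\ell'$ or $\ell\triangleleft\tau$; $\ell\triangleleft\tau_1\times\tau_2$ if $\ell\triangleleft\tau_1$ and $\ell\triangleleft\tau_2$; $\ell\triangleleft(\tau_1\xrightarrow{pc}\tau_2)$ if $\ell\triangleleft\tau_2$ and $\ell\sqsubseteq pc$. *Typing.* $\Gamma\diamond pc\vdash e:\tau$ (with $\Gamma$ a partial map from variables to types) has the standard rules of simply typed $\lambda$-calculus with unit, products and sums, with the same $pc$ in premises and conclusion except for functions, and: - if $\Gamma,x{:}\tau_1\diamond pc_1\vdash e:\tau_2$ then $\Gamma\diamond pc_2\vdash\lambda x{:}\tau_1.\,e:\tau_1\xrightarrow{pc_1}\tau_2$ for every $pc_2$; - if $\Gamma\diamond pc_1\vdash f:\tau_1\xrightarrow{pc_2}\tau_2$, $\Gamma\diamond pc_1\vdash e:\tau_1$ and $pc_1\sqsubseteq pc_2$, then $\Gamma\diamond pc_1\vdash f\,e:\tau_2$;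 - if $\Gamma\diamond pc\vdash e:\tau$ then $\Gamma\diamond pc\vdash\mathsf{label}_\ell(e):\mathsf L_\ell(\tau)$; - if $\Gamma\diamond pc\vdash e_1:\mathsf L_\ell(\tau_1)$, $\Gamma,x{:}\tau_1\diamond pc\sqcup\ell\vdash e_2:\tau_2$ and $\ell\triangleleft\tau_2$, then $\Gamma\diamond pc\vdash\mathsf{unlabel}\ e_1\ \mathsf{as}\ x\ \mathsf{in}\ e_2:\tau_2$; - if $\Gamma\diamond pc'\vdash e:\tau$ and $pc\sqsubseteq pc'$ then $\Gamma\diamond pc\vdash e:\tau$; - $\Gamma\diamond pc\vdash\mathsf{read}:\sigma$; if $\Gamma\diamond pc\vdash e:\sigma$ and $pc\sqsubseteq\ell_{\mathsf{State}}$ then $\Gamma\diamond pc\vdash\mathsf{write}(e):\mathsf{unit}$; - if $pc\sqsubseteq\ell_{\mathsf{Exn}}$ then $\Gamma\diamond pc\vdash\mathsf{throw}:\tau$ for every $\tau$; if $\Gamma\diamond pc\vdash e_1:\tau$, $\Gamma\diamond pc\vdash e_2:\tau$ and $\ell_{\mathsf{Exn}}\triangleleft\tau$ then $\Gamma\diamond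 pc\vdash\mathsf{try}\ e_1\ \mathsf{catch}\ e_2:\tau$. *Evaluation.* $\langle e,s\rangle\longrightarrow\langle e',s'\rangle$, with $s$ the content of the state cell, is the left-to-right call-by-value semantics: the usual reductions for functions, projections and $\mathsf{match}$, leaving $s$ unchanged; $\langle\mathsf{unlabel}\ \mathsf{label}_\ell(v)\ \mathsf{as}\ x\ \mathsf{in}\ e,s\rangle\longrightarrow\langle e[v/x],s\rangle$; $\langle\mathsf{read},s\rangle\longrightarrow\langle s,s\rangle$; $\langle\mathsf{write}(v),s\rangle\longrightarrow\langle(),v\rangle$; $\langle T[\mathsf{throw}],s\rangle\longrightarrow\langle\mathsf{throw},s\rangle$; $\langle\mathsf{try}\ v\ \mathsf{catch}\ e,s\rangle\longrightarrow\langle v,s\rangle$; $\langle\mathsf{try}\ \mathsf{throw}\ \mathsf{catch}\ e,s\rangle\longrightarrow\langle e,s\rangle$; and closure under evaluation contexts. Evaluation contexts place the hole in $\mathsf{label}_\ell(\cdot)$, $\mathsf{write}(\cdot)$, the first argument of $\mathsf{unlabel}$, the $\mathsf{try}$ block, and the usual call-by-value positions of the other constructs; throw contexts $T$ are the evaluation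 contexts that do not enter a $\mathsf{try}$ block. *Equivalence.* Let $\Gamma$ be an environment and $pc,\ell$ labels. Expressions $e_1,e_2$ over $\Gamma$ are *state and exception $\ell$-equivalent under $pc$* if the following holds for every value $s$ with $\diamond\,pc\vdash s:\sigma$ and every one-hole expression context $C$ (whose binders may capture variables of $e_i$) such that both programs $C[e_i]$ have type $\mathsf L_\ell(\mathsf{unit}+\mathsf{unit})$ under $pc$ in the empty environment, by derivations that agree outside the hole and in which the hole is filled using a common judgment $\Gamma\diamond q\vdash e_i:\tau'$ (for some $q,\tau'$), all variables of $\Gamma$ being in scope at the hole with the types given by $\Gamma$: whenever $\langle C[e_i],s\rangle\longrightarrow^*\langle v_i,s_i\rangle$ with $v_i$ a value for $i=1,2$, then $v_1=v_2$ if $\ell_{\mathsf{Exn}}\sqsubseteq\ell$, and $s_1=s_2$ if $\ell_{\mathsf{State}}\sqsubseteq\ell$. *Claim.* Assume that $\sigma$ contains no function type, $\ell_{\mathsf{State}}\triangleleft\sigma$, and $\ell_{\mathsf{Exn}}\sqsubseteq\ell_{\mathsf{State}}$. Let $\Gamma\diamond pc\vdash e_1:\tau$ and $\Gamma\diamond pc\vdash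 e_2:\tau$, and let $\ell$ be a label with $\ell\triangleleft\tau$ and $\ell\sqsubseteq pc$. Then for every label $\ell_{\mathsf{Atk}}$, either $\ell\sqsubseteq\ell_{\mathsf{Atk}}$ or $e_1$ and $e_2$ are state and exception $\ell_{\mathsf{Atk}}$-equivalent under $pc$. If moreover every label occurring in $\sigma$ flows to $\ell_{\mathsf{State}}$, then in the second case they are state and exception $\ell_{\mathsf{Atk}}$-equivalent under every label $pc_0$. -/

import Mathlib

/-- Information-flow labels: a preorder `≤` ("flows to") with a top element in which any two
labels have a least upper bound `⊔`. Antisymmetry is not required. -/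
class LabelOrder (L : Type*) extends Preorder L, OrderTop L, Max L where
  le_sup_left : ∀ a b : L, a ≤ a ⊔ b
  le_sup_right : ∀ a b : L, b ≤ a ⊔ b
  sup_le : ∀ a b c : L, a ≤ c → b ≤ c → a ⊔ b ≤ c

namespace DCC

/-- Program variables. -/
abbrev Var := ℕ

/-- Types; `arrow τ₁ pc τ₂` is the type of functions that may be run under the program counter
label `pc`, and `lab ℓ τ` is `τ` labeled by `ℓ`. -/
inductive Ty (L : Type*) where
  | unit : Ty L
  | sum (τ₁ τ₂ : Ty L) : Ty L
  | prod (τ₁ τ₂ : Ty L) : Ty L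
  | arrow (τ₁ : Ty L) (pc : L) (τ₂ : Ty L) : Ty L
  | lab (ℓ : L) (τ : Ty L) : Ty L

/-- No function type occurs as a subterm. -/
def Ty.FirstOrder {L : Type*} : Ty L → Prop
  | .unit => True
  | .sum τ₁ τ₂ => τ₁.FirstOrder ∧ τ₂.FirstOrder
  | .prod τ₁ τ₂ => τ₁.FirstOrder ∧ τ₂.FirstOrder
  | .arrow _ _ _ => False
  | .lab _ τ => τ.FirstOrder

/-- Every label that occurs in the type flows to `k`: whoever sees level `k` sees all of a
(first-order) value of this type. -/
def Ty.VisibleAt {L : Type*} [LE L] (k : L) : Ty L → Prop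
  | .unit => True
  | .sum τ₁ τ₂ => τ₁.VisibleAt k ∧ τ₂.VisibleAt k
  | .prod τ₁ τ₂ => τ₁.VisibleAt k ∧ τ₂.VisibleAt k
  | .arrow τ₁ pc τ₂ => τ₁.VisibleAt k ∧ pc ≤ k ∧ τ₂.VisibleAt k
  | .lab ℓ τ => ℓ ≤ k ∧ τ.VisibleAt k

/-- `Protects ℓ τ`: the type `τ` protects the label `ℓ`, written `ℓ ◁ τ`. -/
inductive Protects {L : Type*} [LE L] (ℓ : L) : Ty L → Prop where
  | lab_le {ℓ' : L} {τ : Ty L} : ℓ ≤ ℓ' → Protects ℓ (.lab ℓ' τ)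
  | lab_inner {ℓ' : L} {τ : Ty L} : Protects ℓ τ → Protects ℓ (.lab ℓ' τ)
  | prod {τ₁ τ₂ : Ty L} : Protects ℓ τ₁ → Protects ℓ τ₂ → Protects ℓ (.prod τ₁ τ₂)
  | arrow {τ₁ τ₂ : Ty L} {pc : L} : Protects ℓ τ₂ → ℓ ≤ pc → Protects ℓ (.arrow τ₁ pc τ₂)

/-- Expressions. `cases e x e₁ y e₂` is `match e with inl(x) ⇒ e₁ | inr(y) ⇒ e₂`, and
`unlabel e₁ x e₂` is `unlabel e₁ as x in e₂`. -/
inductive Expr (L : Type*) where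
  | var (x : Var) : Expr L
  | unit : Expr L
  | lam (x : Var) (τ : Ty L) (e : Expr L) : Expr L
  | app (e₁ e₂ : Expr L) : Expr L
  | pair (e₁ e₂ : Expr L) : Expr L
  | fst (e : Expr L) : Expr L
  | snd (e : Expr L) : Expr L
  | inl (e : Expr L) : Expr L
  | inr (e : Expr L) : Expr L
  | cases (e : Expr L) (x : Var) (e₁ : Expr L) (y : Var) (e₂ : Expr L) : Expr L
  | label (ℓ : L) (e : Expr L) : Expr L
  | unlabel (e₁ : Expr L) (x : Var) (e₂ : Expr L) : Expr L
  | read : Expr L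
  | write (e : Expr L) : Expr L
  | throw : Expr L
  | tryCatch (e₁ e₂ : Expr L) : Expr L

/-- Values. -/
inductive IsValue {L : Type*} : Expr L → Prop where
  | unit : IsValue .unit
  | inl {v : Expr L} : IsValue v → IsValue (.inl v)
  | inr {v : Expr L} : IsValue v → IsValue (.inr v)
  | pair {v₁ v₂ : Expr L} : IsValue v₁ → IsValue v₂ → IsValue (.pair v₁ v₂)
  | lam (x : Var) (τ : Ty L) (e : Expr L) : IsValue (.lam x τ e)
  | label (ℓ : L) {v : Expr L} : IsValue v → IsValue (.label ℓ v)

/-- `e.subst x v` replaces the free occurrences of `x` in `e` by `v`. Evaluation starts from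
closed programs and closed states, so only closed values are ever substituted and no variable
can be captured. -/
def Expr.subst {L : Type*} : Expr L → Var → Expr L → Expr L
  | .var y, x, v => if y = x then v else .var y
  | .unit, _, _ => .unit
  | .lam y τ e, x, v => .lam y τ (if y = x then e else e.subst x v)
  | .app e₁ e₂, x, v => .app (e₁.subst x v) (e₂.subst x v)
  | .pair e₁ e₂, x, v => .pair (e₁.subst x v) (e₂.subst x v)
  | .fst e, x, v => .fst (e.subst x v)
  | .snd e, x, v => .snd (e.subst x v)
  | .inl e, x, v => .inl (e.subst x v)
  | .inr e, x, v => .inr (e.subst x v)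
  | .cases e y e₁ z e₂, x, v =>
      .cases (e.subst x v) y (if y = x then e₁ else e₁.subst x v)
        z (if z = x then e₂ else e₂.subst x v)
  | .label ℓ e, x, v => .label ℓ (e.subst x v)
  | .unlabel e₁ y e₂, x, v =>
      .unlabel (e₁.subst x v) y (if y = x then e₂ else e₂.subst x v)
  | .read, _, _ => .read
  | .write e, x, v => .write (e.subst x v)
  | .throw, _, _ => .throw
  | .tryCatch e₁ e₂, x, v => .tryCatch (e₁.subst x v) (e₂.subst x v)

/-- Expression contexts: expressions with exactly one hole, at any position. -/
inductive Ctx (L : Type*) where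
  | hole : Ctx L
  | lam (x : Var) (τ : Ty L) (C : Ctx L) : Ctx L
  | appL (C : Ctx L) (e : Expr L) : Ctx L
  | appR (e : Expr L) (C : Ctx L) : Ctx L
  | pairL (C : Ctx L) (e : Expr L) : Ctx L
  | pairR (e : Expr L) (C : Ctx L) : Ctx L
  | fst (C : Ctx L) : Ctx L
  | snd (C : Ctx L) : Ctx L
  | inl (C : Ctx L) : Ctx L
  | inr (C : Ctx L) : Ctx L
  | casesScrut (C : Ctx L) (x : Var) (e₁ : Expr L) (y : Var) (e₂ : Expr L) : Ctx L
  | casesInl (e : Expr L) (x : Var) (C : Ctx L) (y : Var) (e₂ : Expr L) : Ctx L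
  | casesInr (e : Expr L) (x : Var) (e₁ : Expr L) (y : Var) (C : Ctx L) : Ctx L
  | label (ℓ : L) (C : Ctx L) : Ctx L
  | unlabelL (C : Ctx L) (x : Var) (e : Expr L) : Ctx L
  | unlabelR (e : Expr L) (x : Var) (C : Ctx L) : Ctx L
  | write (C : Ctx L) : Ctx L
  | tryL (C : Ctx L) (e : Expr L) : Ctx L
  | catchR (e : Expr L) (C : Ctx L) : Ctx L

/-- `C.plug e` is `C[e]`; the binders of `C` above the hole capture the variables of `e`. -/
def Ctx.plug {L : Type*} : Ctx L → Expr L → Expr L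
  | .hole, t => t
  | .lam x τ C, t => .lam x τ (C.plug t)
  | .appL C e, t => .app (C.plug t) e
  | .appR e C, t => .app e (C.plug t)
  | .pairL C e, t => .pair (C.plug t) e
  | .pairR e C, t => .pair e (C.plug t)
  | .fst C, t => .fst (C.plug t)
  | .snd C, t => .snd (C.plug t)
  | .inl C, t => .inl (C.plug t)
  | .inr C, t => .inr (C.plug t)
  | .casesScrut C x e₁ y e₂, t => .cases (C.plug t) x e₁ y e₂
  | .casesInl e x C y e₂, t => .cases e x (C.plug t) y e₂
  | .casesInr e x e₁ y C, t => .cases e x e₁ y (C.plug t)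
  | .label ℓ C, t => .label ℓ (C.plug t)
  | .unlabelL C x e, t => .unlabel (C.plug t) x e
  | .unlabelR e x C, t => .unlabel e x (C.plug t)
  | .write C, t => .write (C.plug t)
  | .tryL C e, t => .tryCatch (C.plug t) e
  | .catchR e C, t => .tryCatch e (C.plug t)

/-- Throw contexts `T`. -/
inductive Ctx.IsThrow {L : Type*} : Ctx L → Prop where
  | hole : IsThrow .hole
  | appL {C : Ctx L} (e : Expr L) : IsThrow C → IsThrow (.appL C e)
  | appR {C : Ctx L} {v : Expr L} : IsValue v → IsThrow C → IsThrow (.appR v C)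
  | pairL {C : Ctx L} (e : Expr L) : IsThrow C → IsThrow (.pairL C e)
  | pairR {C : Ctx L} {v : Expr L} : IsValue v → IsThrow C → IsThrow (.pairR v C)
  | fst {C : Ctx L} : IsThrow C → IsThrow (.fst C)
  | snd {C : Ctx L} : IsThrow C → IsThrow (.snd C)
  | inl {C : Ctx L} : IsThrow C → IsThrow (.inl C)
  | inr {C : Ctx L} : IsThrow C → IsThrow (.inr C)
  | casesScrut {C : Ctx L} (x : Var) (e₁ : Expr L) (y : Var) (e₂ : Expr L) :
      IsThrow C → IsThrow (.casesScrut C x e₁ y e₂)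
  | label {C : Ctx L} (ℓ : L) : IsThrow C → IsThrow (.label ℓ C)
  | unlabelL {C : Ctx L} (x : Var) (e : Expr L) : IsThrow C → IsThrow (.unlabelL C x e)
  | write {C : Ctx L} : IsThrow C → IsThrow (.write C)

/-- Evaluation contexts `E`: in addition to the throw contexts, evaluation may take place inside
a `try` block. -/
inductive Ctx.IsEval {L : Type*} : Ctx L → Prop where
  | hole : IsEval .hole
  | appL {C : Ctx L} (e : Expr L) : IsEval C → IsEval (.appL C e)
  | appR {C : Ctx L} {v : Expr L} : IsValue v → IsEval C → IsEval (.appR v C)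
  | pairL {C : Ctx L} (e : Expr L) : IsEval C → IsEval (.pairL C e)
  | pairR {C : Ctx L} {v : Expr L} : IsValue v → IsEval C → IsEval (.pairR v C)
  | fst {C : Ctx L} : IsEval C → IsEval (.fst C)
  | snd {C : Ctx L} : IsEval C → IsEval (.snd C)
  | inl {C : Ctx L} : IsEval C → IsEval (.inl C)
  | inr {C : Ctx L} : IsEval C → IsEval (.inr C)
  | casesScrut {C : Ctx L} (x : Var) (e₁ : Expr L) (y : Var) (e₂ : Expr L) :
      IsEval C → IsEval (.casesScrut C x e₁ y e₂)
  | label {C : Ctx L} (ℓ : L) : IsEval C → IsEval (.label ℓ C)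
  | unlabelL {C : Ctx L} (x : Var) (e : Expr L) : IsEval C → IsEval (.unlabelL C x e)
  | write {C : Ctx L} : IsEval C → IsEval (.write C)
  | tryL {C : Ctx L} (e : Expr L) : IsEval C → IsEval (.tryL C e)

/-- Call-by-value small steps on pairs of an expression and the content of the state cell. -/
inductive Step {L : Type*} : Expr L × Expr L → Expr L × Expr L → Prop where
  | ctx {E : Ctx L} {e e' s s' : Expr L} : E.IsEval → Step (e, s) (e', s') →
      Step (E.plug e, s) (E.plug e', s')
  | beta (x : Var) (τ : Ty L) (e : Expr L) {v : Expr L} (s : Expr L) : IsValue v →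
      Step (.app (.lam x τ e) v, s) (e.subst x v, s)
  | fst {v₁ v₂ : Expr L} (s : Expr L) : IsValue v₁ → IsValue v₂ →
      Step (.fst (.pair v₁ v₂), s) (v₁, s)
  | snd {v₁ v₂ : Expr L} (s : Expr L) : IsValue v₁ → IsValue v₂ →
      Step (.snd (.pair v₁ v₂), s) (v₂, s)
  | casesInl {v : Expr L} (x : Var) (e₁ : Expr L) (y : Var) (e₂ : Expr L) (s : Expr L) :
      IsValue v → Step (.cases (.inl v) x e₁ y e₂, s) (e₁.subst x v, s)
  | casesInr {v : Expr L} (x : Var) (e₁ : Expr L) (y : Var) (e₂ : Expr L) (s : Expr L) :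
      IsValue v → Step (.cases (.inr v) x e₁ y e₂, s) (e₂.subst y v, s)
  | unlabel (ℓ : L) {v : Expr L} (x : Var) (e : Expr L) (s : Expr L) : IsValue v →
      Step (.unlabel (.label ℓ v) x e, s) (e.subst x v, s)
  | read (s : Expr L) : Step (.read, s) (s, s)
  | write {v : Expr L} (s : Expr L) : IsValue v → Step (.write v, s) (.unit, v)
  | throw {T : Ctx L} (s : Expr L) : T.IsThrow → Step (T.plug .throw, s) (.throw, s)
  | tryValue {v : Expr L} (e s : Expr L) : IsValue v → Step (.tryCatch v e, s) (v, s)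
  | tryThrow (e s : Expr L) : Step (.tryCatch .throw e, s) (e, s)

/-- Many steps. -/
def Steps {L : Type*} : Expr L × Expr L → Expr L × Expr L → Prop := Relation.ReflTransGen Step

/-- The parameters of the language: the type `σ` of the state cell, the label at which the state
is visible, and the label at which exceptions are visible. -/
structure Params (L : Type*) where
  σ : Ty L
  lState : L
  lExn : L

/-- Typing environments. -/
abbrev Env (L : Type*) := Var → Option (Ty L)

/-- The empty environment. -/
def Env.empty {L : Type*} : Env L := fun _ => none

/-- `Γ.cons x τ` is `Γ, x : τ`. -/
def Env.cons {L : Type*} (Γ : Env L) (x : Var) (τ : Ty L) : Env L :=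
  Function.update Γ x (some τ)

/-- `HasType P Γ pc e τ` is the judgment `Γ ⋄ pc ⊢ e : τ`. -/
inductive HasType {L : Type*} [LabelOrder L] (P : Params L) :
    Env L → L → Expr L → Ty L → Prop where
  | var {Γ : Env L} {pc : L} {x : Var} {τ : Ty L} : Γ x = some τ → HasType P Γ pc (.var x) τ
  | unit {Γ : Env L} {pc : L} : HasType P Γ pc .unit .unit
  | pair {Γ : Env L} {pc : L} {e₁ e₂ : Expr L} {τ₁ τ₂ : Ty L} :
      HasType P Γ pc e₁ τ₁ → HasType P Γ pc e₂ τ₂ → HasType P Γ pc (.pair e₁ e₂) (.prod τ₁ τ₂)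
  | fst {Γ : Env L} {pc : L} {e : Expr L} {τ₁ τ₂ : Ty L} :
      HasType P Γ pc e (.prod τ₁ τ₂) → HasType P Γ pc (.fst e) τ₁
  | snd {Γ : Env L} {pc : L} {e : Expr L} {τ₁ τ₂ : Ty L} :
      HasType P Γ pc e (.prod τ₁ τ₂) → HasType P Γ pc (.snd e) τ₂
  | inl {Γ : Env L} {pc : L} {e : Expr L} {τ₁ τ₂ : Ty L} :
      HasType P Γ pc e τ₁ → HasType P Γ pc (.inl e) (.sum τ₁ τ₂)
  | inr {Γ : Env L} {pc : L} {e : Expr L} {τ₁ τ₂ : Ty L} :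
      HasType P Γ pc e τ₂ → HasType P Γ pc (.inr e) (.sum τ₁ τ₂)
  | cases {Γ : Env L} {pc : L} {e e₁ e₂ : Expr L} {x y : Var} {τ₁ τ₂ τ : Ty L} :
      HasType P Γ pc e (.sum τ₁ τ₂) → HasType P (Γ.cons x τ₁) pc e₁ τ →
      HasType P (Γ.cons y τ₂) pc e₂ τ → HasType P Γ pc (.cases e x e₁ y e₂) τ
  | lam {Γ : Env L} {pc₁ pc₂ : L} {x : Var} {e : Expr L} {τ₁ τ₂ : Ty L} :
      HasType P (Γ.cons x τ₁) pc₁ e τ₂ → HasType P Γ pc₂ (.lam x τ₁ e) (.arrow τ₁ pc₁ τ₂)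
  | app {Γ : Env L} {pc₁ pc₂ : L} {f e : Expr L} {τ₁ τ₂ : Ty L} :
      HasType P Γ pc₁ f (.arrow τ₁ pc₂ τ₂) → HasType P Γ pc₁ e τ₁ → pc₁ ≤ pc₂ →
      HasType P Γ pc₁ (.app f e) τ₂
  | label {Γ : Env L} {pc ℓ : L} {e : Expr L} {τ : Ty L} :
      HasType P Γ pc e τ → HasType P Γ pc (.label ℓ e) (.lab ℓ τ)
  | unlabel {Γ : Env L} {pc ℓ : L} {e₁ e₂ : Expr L} {x : Var} {τ₁ τ₂ : Ty L} :
      HasType P Γ pc e₁ (.lab ℓ τ₁) → HasType P (Γ.cons x τ₁) (pc ⊔ ℓ) e₂ τ₂ →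
      Protects ℓ τ₂ → HasType P Γ pc (.unlabel e₁ x e₂) τ₂
  | variance {Γ : Env L} {pc pc' : L} {e : Expr L} {τ : Ty L} :
      HasType P Γ pc' e τ → pc ≤ pc' → HasType P Γ pc e τ
  | read {Γ : Env L} {pc : L} : HasType P Γ pc .read P.σ
  | write {Γ : Env L} {pc : L} {e : Expr L} :
      HasType P Γ pc e P.σ → pc ≤ P.lState → HasType P Γ pc (.write e) .unit
  | throw {Γ : Env L} {pc : L} {τ : Ty L} : pc ≤ P.lExn → HasType P Γ pc .throw τ
  | tryCatch {Γ : Env L} {pc : L} {e₁ e₂ : Expr L} {τ : Ty L} :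
      HasType P Γ pc e₁ τ → HasType P Γ pc e₂ τ → Protects P.lExn τ →
      HasType P Γ pc (.tryCatch e₁ e₂) τ

/-- `CtxHasType P Γ pc τ Δ pc' C τ'`: assuming that the hole is an expression with
`Γ ⋄ pc ⊢ □ : τ`, the typing rules give `Δ ⋄ pc' ⊢ C : τ'`. At the hole, the variables of `Γ`
have to be in scope with the types that `Γ` gives them; there may be further variables. -/
inductive CtxHasType {L : Type*} [LabelOrder L] (P : Params L) (Γ : Env L) (pc : L) (τ : Ty L) :
    Env L → L → Ctx L → Ty L → Prop where
  | hole {Δ : Env L} : (∀ x τ₀, Γ x = some τ₀ → Δ x = some τ₀) →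
      CtxHasType P Γ pc τ Δ pc .hole τ
  | pairL {Δ : Env L} {q : L} {C : Ctx L} {e : Expr L} {τ₁ τ₂ : Ty L} :
      CtxHasType P Γ pc τ Δ q C τ₁ → HasType P Δ q e τ₂ →
      CtxHasType P Γ pc τ Δ q (.pairL C e) (.prod τ₁ τ₂)
  | pairR {Δ : Env L} {q : L} {C : Ctx L} {e : Expr L} {τ₁ τ₂ : Ty L} :
      HasType P Δ q e τ₁ → CtxHasType P Γ pc τ Δ q C τ₂ →
      CtxHasType P Γ pc τ Δ q (.pairR e C) (.prod τ₁ τ₂)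
  | fst {Δ : Env L} {q : L} {C : Ctx L} {τ₁ τ₂ : Ty L} :
      CtxHasType P Γ pc τ Δ q C (.prod τ₁ τ₂) → CtxHasType P Γ pc τ Δ q (.fst C) τ₁
  | snd {Δ : Env L} {q : L} {C : Ctx L} {τ₁ τ₂ : Ty L} :
      CtxHasType P Γ pc τ Δ q C (.prod τ₁ τ₂) → CtxHasType P Γ pc τ Δ q (.snd C) τ₂
  | inl {Δ : Env L} {q : L} {C : Ctx L} {τ₁ τ₂ : Ty L} :
      CtxHasType P Γ pc τ Δ q C τ₁ → CtxHasType P Γ pc τ Δ q (.inl C) (.sum τ₁ τ₂)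
  | inr {Δ : Env L} {q : L} {C : Ctx L} {τ₁ τ₂ : Ty L} :
      CtxHasType P Γ pc τ Δ q C τ₂ → CtxHasType P Γ pc τ Δ q (.inr C) (.sum τ₁ τ₂)
  | casesScrut {Δ : Env L} {q : L} {C : Ctx L} {e₁ e₂ : Expr L} {x y : Var} {τ₁ τ₂ τ' : Ty L} :
      CtxHasType P Γ pc τ Δ q C (.sum τ₁ τ₂) → HasType P (Δ.cons x τ₁) q e₁ τ' →
      HasType P (Δ.cons y τ₂) q e₂ τ' →
      CtxHasType P Γ pc τ Δ q (.casesScrut C x e₁ y e₂) τ'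
  | casesInl {Δ : Env L} {q : L} {C : Ctx L} {e e₂ : Expr L} {x y : Var} {τ₁ τ₂ τ' : Ty L} :
      HasType P Δ q e (.sum τ₁ τ₂) → CtxHasType P Γ pc τ (Δ.cons x τ₁) q C τ' →
      HasType P (Δ.cons y τ₂) q e₂ τ' →
      CtxHasType P Γ pc τ Δ q (.casesInl e x C y e₂) τ'
  | casesInr {Δ : Env L} {q : L} {C : Ctx L} {e e₁ : Expr L} {x y : Var} {τ₁ τ₂ τ' : Ty L} :
      HasType P Δ q e (.sum τ₁ τ₂) → HasType P (Δ.cons x τ₁) q e₁ τ' →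
      CtxHasType P Γ pc τ (Δ.cons y τ₂) q C τ' →
      CtxHasType P Γ pc τ Δ q (.casesInr e x e₁ y C) τ'
  | lam {Δ : Env L} {q₁ q₂ : L} {x : Var} {C : Ctx L} {τ₁ τ₂ : Ty L} :
      CtxHasType P Γ pc τ (Δ.cons x τ₁) q₁ C τ₂ →
      CtxHasType P Γ pc τ Δ q₂ (.lam x τ₁ C) (.arrow τ₁ q₁ τ₂)
  | appL {Δ : Env L} {q₁ q₂ : L} {C : Ctx L} {e : Expr L} {τ₁ τ₂ : Ty L} :
      CtxHasType P Γ pc τ Δ q₁ C (.arrow τ₁ q₂ τ₂) → HasType P Δ q₁ e τ₁ → q₁ ≤ q₂ →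
      CtxHasType P Γ pc τ Δ q₁ (.appL C e) τ₂
  | appR {Δ : Env L} {q₁ q₂ : L} {C : Ctx L} {f : Expr L} {τ₁ τ₂ : Ty L} :
      HasType P Δ q₁ f (.arrow τ₁ q₂ τ₂) → CtxHasType P Γ pc τ Δ q₁ C τ₁ → q₁ ≤ q₂ →
      CtxHasType P Γ pc τ Δ q₁ (.appR f C) τ₂
  | label {Δ : Env L} {q ℓ : L} {C : Ctx L} {τ' : Ty L} :
      CtxHasType P Γ pc τ Δ q C τ' → CtxHasType P Γ pc τ Δ q (.label ℓ C) (.lab ℓ τ')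
  | unlabelL {Δ : Env L} {q ℓ : L} {C : Ctx L} {e : Expr L} {x : Var} {τ₁ τ₂ : Ty L} :
      CtxHasType P Γ pc τ Δ q C (.lab ℓ τ₁) → HasType P (Δ.cons x τ₁) (q ⊔ ℓ) e τ₂ →
      Protects ℓ τ₂ → CtxHasType P Γ pc τ Δ q (.unlabelL C x e) τ₂
  | unlabelR {Δ : Env L} {q ℓ : L} {C : Ctx L} {e : Expr L} {x : Var} {τ₁ τ₂ : Ty L} :
      HasType P Δ q e (.lab ℓ τ₁) → CtxHasType P Γ pc τ (Δ.cons x τ₁) (q ⊔ ℓ) C τ₂ →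
      Protects ℓ τ₂ → CtxHasType P Γ pc τ Δ q (.unlabelR e x C) τ₂
  | variance {Δ : Env L} {q q' : L} {C : Ctx L} {τ' : Ty L} :
      CtxHasType P Γ pc τ Δ q' C τ' → q ≤ q' → CtxHasType P Γ pc τ Δ q C τ'
  | write {Δ : Env L} {q : L} {C : Ctx L} :
      CtxHasType P Γ pc τ Δ q C P.σ → q ≤ P.lState → CtxHasType P Γ pc τ Δ q (.write C) .unit
  | tryL {Δ : Env L} {q : L} {C : Ctx L} {e : Expr L} {τ' : Ty L} :
      CtxHasType P Γ pc τ Δ q C τ' → HasType P Δ q e τ' → Protects P.lExn τ' →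
      CtxHasType P Γ pc τ Δ q (.tryL C e) τ'
  | catchR {Δ : Env L} {q : L} {C : Ctx L} {e : Expr L} {τ' : Ty L} :
      HasType P Δ q e τ' → CtxHasType P Γ pc τ Δ q C τ' → Protects P.lExn τ' →
      CtxHasType P Γ pc τ Δ q (.catchR e C) τ'

/-- State-and-exception `ℓ`-equivalence of two expressions over `Γ`, tested by the programs
`C[e₁]`, `C[e₂]` of type `lab ℓ (unit + unit)` that are well typed under `pc`. The two programs
share the typing of the hole, that is, the label `q` and the type `τ` given there to `e₁` and `e₂`
over `Γ`. -/
def StExnEquiv {L : Type*} [LabelOrder L] (P : Params L) (Γ : Env L) (pc ℓ : L)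
    (e₁ e₂ : Expr L) : Prop :=
  ∀ (s : Expr L) (C : Ctx L) (q : L) (τ : Ty L) (v₁ v₂ s₁ s₂ : Expr L),
    IsValue s → HasType P Env.empty pc s P.σ →
    HasType P Γ q e₁ τ → HasType P Γ q e₂ τ →
    CtxHasType P Γ q τ Env.empty pc C (.lab ℓ (.sum .unit .unit)) →
    IsValue v₁ → IsValue v₂ →
    Steps (C.plug e₁, s) (v₁, s₁) → Steps (C.plug e₂, s) (v₂, s₂) →
    (P.lExn ≤ ℓ → v₁ = v₂) ∧ (P.lState ≤ ℓ → s₁ = s₂)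

end DCC

/-!
Noninterference is proved by a syntactic simulation. Fix the attacker's label `A`. Two expressions
are *hidden* from `A` (`Hidden`) if, besides the typing that their context uses, they share a typing
at a type that protects some label `h` and under a program counter above `h`, where `h` does not
flow to `A`. *Low equivalence* (`Rel`) is the closure of hiddenness under all typing rules. A
second typing is needed because types are not unique (latent labels of functions, the unused summand
of an injection, `throw`): the hole of a testing context may use `e₁` and `e₂` at a type that no
longer protects anything, although they still behave as their protected type dictates.

The core is `Rel.eval`: if exceptions are visible to `A`, then big-step evaluation maps low
equivalent expressions in low equivalent states to low equivalent outcomes and states. Where the two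
expressions are built by the same rule, this is an induction on evaluation, using that `Rel` is
preserved by substituting closed values (`Rel.subst`) and that low equivalent values have low
equivalent components (`Rel.pair_inv`, `Rel.beta`, and so on). When a label that `A` cannot
see is removed, the two bodies become hidden (`Rel.unlabel_body`). Hidden expressions are handled
by confinement (`Eval.outcomeTyped`): well-typed code that throws has its program counter below
`lExn`, and code that changes the state has it below `lState`. So hidden code does not throw, since
`lExn ≤ A`, and either it leaves the state alone or `lState` does not flow to `A`, in which case
`σ`, protecting `lState`, makes any two states hidden. Its results are hidden again.

A value without functions cannot be hidden if all labels of its type flow to `A`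
(`Protects.le_of_visibleAt`), so low equivalence at such a type is equality
(`Rel.eq_of_visibleAt`). This gives equal results at `lab A (unit + unit)`, and equal states when
all of `σ` is visible at `lState`. For the program counter `pc` itself there is nothing to compare:
a label `ℓ ≤ pc` that `A` cannot see rules out any visible write, so both runs keep the initial
state. If exceptions are not visible to `A`, neither is the state, and nothing is claimed.
-/

namespace DCC

variable {L : Type*}

theorem sup_mono_left [LabelOrder L] {a b : L} (c : L) (h : a ≤ b) : a ⊔ c ≤ b ⊔ c :=
  LabelOrder.sup_le _ _ _ (h.trans (LabelOrder.le_sup_left _ _)) (LabelOrder.le_sup_right _ _)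

/-! ### Big-step evaluation -/

/-- What a terminating evaluation yields: a value or an uncaught exception. -/
inductive Outcome (L : Type*) where
  | val (v : Expr L) : Outcome L
  | throw : Outcome L

/-- Big-step evaluation: `Eval e s r s'` says that `e`, started in the state `s`, yields the outcome
`r` and the state `s'`. -/
inductive Eval : Expr L → Expr L → Outcome L → Expr L → Prop where
  | unit {s : Expr L} : Eval .unit s (.val .unit) s
  | lam {x : Var} {τ : Ty L} {e s : Expr L} : Eval (.lam x τ e) s (.val (.lam x τ e)) s
  | app {f a b v s s₁ s₂ s₃ : Expr L} {x : Var} {τ : Ty L} {r : Outcome L} :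
      Eval f s (.val (.lam x τ b)) s₁ → Eval a s₁ (.val v) s₂ → Eval (b.subst x v) s₂ r s₃ →
      Eval (.app f a) s r s₃
  | appThrowL {f a s s₁ : Expr L} : Eval f s .throw s₁ → Eval (.app f a) s .throw s₁
  | appThrowR {f a v s s₁ s₂ : Expr L} :
      Eval f s (.val v) s₁ → Eval a s₁ .throw s₂ → Eval (.app f a) s .throw s₂
  | pair {e₁ e₂ v₁ v₂ s s₁ s₂ : Expr L} : Eval e₁ s (.val v₁) s₁ → Eval e₂ s₁ (.val v₂) s₂ →
      Eval (.pair e₁ e₂) s (.val (.pair v₁ v₂)) s₂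
  | pairThrowL {e₁ e₂ s s₁ : Expr L} : Eval e₁ s .throw s₁ → Eval (.pair e₁ e₂) s .throw s₁
  | pairThrowR {e₁ e₂ v s s₁ s₂ : Expr L} :
      Eval e₁ s (.val v) s₁ → Eval e₂ s₁ .throw s₂ → Eval (.pair e₁ e₂) s .throw s₂
  | fst {e v₁ v₂ s s₁ : Expr L} : Eval e s (.val (.pair v₁ v₂)) s₁ → Eval (.fst e) s (.val v₁) s₁
  | fstThrow {e s s₁ : Expr L} : Eval e s .throw s₁ → Eval (.fst e) s .throw s₁
  | snd {e v₁ v₂ s s₁ : Expr L} : Eval e s (.val (.pair v₁ v₂)) s₁ → Eval (.snd e) s (.val v₂) s₁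
  | sndThrow {e s s₁ : Expr L} : Eval e s .throw s₁ → Eval (.snd e) s .throw s₁
  | inl {e v s s₁ : Expr L} : Eval e s (.val v) s₁ → Eval (.inl e) s (.val (.inl v)) s₁
  | inlThrow {e s s₁ : Expr L} : Eval e s .throw s₁ → Eval (.inl e) s .throw s₁
  | inr {e v s s₁ : Expr L} : Eval e s (.val v) s₁ → Eval (.inr e) s (.val (.inr v)) s₁
  | inrThrow {e s s₁ : Expr L} : Eval e s .throw s₁ → Eval (.inr e) s .throw s₁
  | casesInl {e e₁ e₂ v s s₁ s₂ : Expr L} {x y : Var} {r : Outcome L} :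
      Eval e s (.val (.inl v)) s₁ → Eval (e₁.subst x v) s₁ r s₂ → Eval (.cases e x e₁ y e₂) s r s₂
  | casesInr {e e₁ e₂ v s s₁ s₂ : Expr L} {x y : Var} {r : Outcome L} :
      Eval e s (.val (.inr v)) s₁ → Eval (e₂.subst y v) s₁ r s₂ → Eval (.cases e x e₁ y e₂) s r s₂
  | casesThrow {e e₁ e₂ s s₁ : Expr L} {x y : Var} :
      Eval e s .throw s₁ → Eval (.cases e x e₁ y e₂) s .throw s₁
  | label {ℓ : L} {e v s s₁ : Expr L} :
      Eval e s (.val v) s₁ → Eval (.label ℓ e) s (.val (.label ℓ v)) s₁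
  | labelThrow {ℓ : L} {e s s₁ : Expr L} : Eval e s .throw s₁ → Eval (.label ℓ e) s .throw s₁
  | unlabel {ℓ : L} {e₁ e₂ v s s₁ s₂ : Expr L} {x : Var} {r : Outcome L} :
      Eval e₁ s (.val (.label ℓ v)) s₁ → Eval (e₂.subst x v) s₁ r s₂ →
      Eval (.unlabel e₁ x e₂) s r s₂
  | unlabelThrow {e₁ e₂ s s₁ : Expr L} {x : Var} :
      Eval e₁ s .throw s₁ → Eval (.unlabel e₁ x e₂) s .throw s₁
  | read {s : Expr L} : Eval .read s (.val s) s
  | write {e v s s₁ : Expr L} : Eval e s (.val v) s₁ → Eval (.write e) s (.val .unit) v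
  | writeThrow {e s s₁ : Expr L} : Eval e s .throw s₁ → Eval (.write e) s .throw s₁
  | throw {s : Expr L} : Eval .throw s .throw s
  | tryValue {e₁ e₂ v s s₁ : Expr L} :
      Eval e₁ s (.val v) s₁ → Eval (.tryCatch e₁ e₂) s (.val v) s₁
  | tryThrow {e₁ e₂ s s₁ s₂ : Expr L} {r : Outcome L} :
      Eval e₁ s .throw s₁ → Eval e₂ s₁ r s₂ → Eval (.tryCatch e₁ e₂) s r s₂

theorem IsValue.eval {v : Expr L} (hv : IsValue v) (s : Expr L) : Eval v s (.val v) s := by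
  induction hv with
  | unit => exact .unit
  | inl _ ih => exact .inl ih
  | inr _ ih => exact .inr ih
  | pair _ _ ih₁ ih₂ => exact .pair ih₁ ih₂
  | lam => exact .lam
  | label _ _ ih => exact .label ih

theorem IsValue.eval_eq {v s s' : Expr L} {r : Outcome L} (hv : IsValue v) (h : Eval v s r s') :
    r = .val v ∧ s' = s := by
  induction hv generalizing s r s' with
  | unit => cases h; exact ⟨rfl, rfl⟩
  | lam => cases h; exact ⟨rfl, rfl⟩
  | pair _ _ ih₁ ih₂ =>
    cases h with
    | pair h₁ h₂ => grind
    | pairThrowL h₁ => grind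
    | pairThrowR h₁ h₂ => grind
  | _ => cases h <;> grind

theorem Eval.isValue {e s s' : Expr L} {r : Outcome L} (h : Eval e s r s') (hs : IsValue s) :
    IsValue s' ∧ ∀ v, r = .val v → IsValue v := by
  induction h with
  | unit => exact ⟨hs, by rintro _ ⟨⟩; exact .unit⟩
  | lam => exact ⟨hs, by rintro _ ⟨⟩; exact .lam _ _ _⟩
  | fst _ ih =>
    obtain ⟨h₁, h₂⟩ := ih hs
    refine ⟨h₁, ?_⟩
    rintro _ ⟨⟩
    cases h₂ _ rfl
    assumption
  | snd _ ih =>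
    obtain ⟨h₁, h₂⟩ := ih hs
    refine ⟨h₁, ?_⟩
    rintro _ ⟨⟩
    cases h₂ _ rfl
    assumption
  | _ => grind [IsValue]

/-- Every evaluation of `E[e']` evaluates `e'` in the given state first, so `e'` may be replaced there
by an expression and a state that evaluate in the same way. -/
theorem Ctx.IsEval.eval_plug {E : Ctx L} {e e' s s' : Expr L} (hE : E.IsEval)
    (h : ∀ r s'', Eval e' s' r s'' → Eval e s r s'') (r : Outcome L) (s'' : Expr L)
    (hev : Eval (E.plug e') s' r s'') : Eval (E.plug e) s r s'' := by
  induction hE generalizing r s'' with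
  | hole => exact h _ _ hev
  | appR hv _ ih =>
    cases hev with
    | app h₁ h₂ h₃ =>
      obtain ⟨⟨⟩, rfl⟩ := hv.eval_eq h₁
      exact .app .lam (ih _ _ h₂) h₃
    | appThrowL h₁ => exact nomatch (hv.eval_eq h₁).1
    | appThrowR h₁ h₂ =>
      obtain ⟨⟨⟩, rfl⟩ := hv.eval_eq h₁
      exact .appThrowR (hv.eval _) (ih _ _ h₂)
  | pairR hv _ ih =>
    cases hev with
    | pair h₁ h₂ =>
      obtain ⟨⟨⟩, rfl⟩ := hv.eval_eq h₁
      exact .pair (hv.eval _) (ih _ _ h₂)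
    | pairThrowL h₁ => exact nomatch (hv.eval_eq h₁).1
    | pairThrowR h₁ h₂ =>
      obtain ⟨⟨⟩, rfl⟩ := hv.eval_eq h₁
      exact .pairThrowR (hv.eval _) (ih _ _ h₂)
  | _ => cases hev <;> simp only [Ctx.plug] <;> grind [Eval]

theorem Ctx.IsThrow.eval_plug {T : Ctx L} (hT : T.IsThrow) (s : Expr L) :
    Eval (T.plug .throw) s .throw s := by
  induction hT with
  | hole => exact .throw
  | appL _ _ ih => exact .appThrowL ih
  | appR hv _ ih => exact .appThrowR (hv.eval _) ih
  | pairL _ _ ih => exact .pairThrowL ih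
  | pairR hv _ ih => exact .pairThrowR (hv.eval _) ih
  | fst _ ih => exact .fstThrow ih
  | snd _ ih => exact .sndThrow ih
  | inl _ ih => exact .inlThrow ih
  | inr _ ih => exact .inrThrow ih
  | casesScrut _ _ _ _ _ ih => exact .casesThrow ih
  | label _ _ ih => exact .labelThrow ih
  | unlabelL _ _ _ ih => exact .unlabelThrow ih
  | write _ ih => exact .writeThrow ih

theorem Step.isValue_state {c c' : Expr L × Expr L} (h : Step c c') (hs : IsValue c.2) :
    IsValue c'.2 := by
  induction h with
  | ctx _ _ ih => exact ih hs
  | write _ hv => exact hv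
  | _ => exact hs

/-- Big-step evaluation is closed under expansion of small steps. The state has to be a value, as
`read` puts it into evaluation position. -/
theorem Step.eval {c c' : Expr L × Expr L} (h : Step c c') (hs : IsValue c.2) {r : Outcome L}
    {s'' : Expr L} (hev : Eval c'.1 c'.2 r s'') : Eval c.1 c.2 r s'' := by
  induction h generalizing r s'' with
  | ctx hE _ ih => exact hE.eval_plug (fun _ _ => ih hs) _ _ hev
  | beta _ _ _ _ hv => exact .app .lam (hv.eval _) hev
  | fst _ h₁ h₂ =>
    obtain ⟨rfl, rfl⟩ := h₁.eval_eq hev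
    exact .fst ((h₁.pair h₂).eval _)
  | snd _ h₁ h₂ =>
    obtain ⟨rfl, rfl⟩ := h₂.eval_eq hev
    exact .snd ((h₁.pair h₂).eval _)
  | casesInl _ _ _ _ _ hv => exact .casesInl (hv.inl.eval _) hev
  | casesInr _ _ _ _ _ hv => exact .casesInr (hv.inr.eval _) hev
  | unlabel ℓ _ _ _ hv => exact .unlabel ((hv.label ℓ).eval _) hev
  | read =>
    obtain ⟨rfl, rfl⟩ := hs.eval_eq hev
    exact .read
  | write _ hv =>
    cases hev
    exact .write (hv.eval _)
  | throw _ hT =>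
    cases hev
    exact hT.eval_plug _
  | tryValue _ _ hv =>
    obtain ⟨rfl, rfl⟩ := hv.eval_eq hev
    exact .tryValue (hv.eval _)
  | tryThrow => exact .tryThrow .throw hev

theorem Steps.eval {e s v s' : Expr L} (h : Steps (e, s) (v, s')) (hs : IsValue s)
    (hv : IsValue v) : Eval e s (.val v) s' := by
  suffices H : ∀ c : Expr L × Expr L, Steps c (v, s') → IsValue c.2 →
      Eval c.1 c.2 (.val v) s' from H _ h hs
  intro c hc
  induction hc using Relation.ReflTransGen.head_induction_on with
  | refl => exact fun _ => hv.eval _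
  | head hstep _ ih => exact fun hs => hstep.eval hs (ih (hstep.isValue_state hs))

/-! ### Typing environments -/

theorem Env.cons_mono {Γ Δ : Env L} (h : ∀ x t, Γ x = some t → Δ x = some t) (y : Var) (τ : Ty L) :
    ∀ x t, Γ.cons y τ x = some t → Δ.cons y τ x = some t := by
  intro x t
  by_cases hxy : x = y
  · subst hxy; simp [Env.cons]
  · simpa [Env.cons, hxy] using h x t

theorem Env.cons_idem (Γ : Env L) (x : Var) (τ τ' : Ty L) :
    (Γ.cons x τ).cons x τ' = Γ.cons x τ' :=
  Function.update_idem _ _ _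

theorem Env.cons_comm (Γ : Env L) {x y : Var} (hxy : y ≠ x) (τ τ' : Ty L) :
    (Γ.cons x τ).cons y τ' = (Γ.cons y τ').cons x τ :=
  Function.update_comm hxy.symm _ _ _

variable [LabelOrder L] {P : Params L} {A : L}

/-! ### Typing without the variance rule -/

/-- The typing rules other than `HasType.variance`, which is admissible (`Typed.mono`). The rules are
then syntax-directed, so that case analysis on a derivation inverts it. -/
inductive Typed (P : Params L) : Env L → L → Expr L → Ty L → Prop where
  | var {Γ : Env L} {pc : L} {x : Var} {τ : Ty L} : Γ x = some τ → Typed P Γ pc (.var x) τ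
  | unit {Γ : Env L} {pc : L} : Typed P Γ pc .unit .unit
  | pair {Γ : Env L} {pc : L} {e₁ e₂ : Expr L} {τ₁ τ₂ : Ty L} :
      Typed P Γ pc e₁ τ₁ → Typed P Γ pc e₂ τ₂ → Typed P Γ pc (.pair e₁ e₂) (.prod τ₁ τ₂)
  | fst {Γ : Env L} {pc : L} {e : Expr L} {τ₁ τ₂ : Ty L} :
      Typed P Γ pc e (.prod τ₁ τ₂) → Typed P Γ pc (.fst e) τ₁
  | snd {Γ : Env L} {pc : L} {e : Expr L} {τ₁ τ₂ : Ty L} :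
      Typed P Γ pc e (.prod τ₁ τ₂) → Typed P Γ pc (.snd e) τ₂
  | inl {Γ : Env L} {pc : L} {e : Expr L} {τ₁ τ₂ : Ty L} :
      Typed P Γ pc e τ₁ → Typed P Γ pc (.inl e) (.sum τ₁ τ₂)
  | inr {Γ : Env L} {pc : L} {e : Expr L} {τ₁ τ₂ : Ty L} :
      Typed P Γ pc e τ₂ → Typed P Γ pc (.inr e) (.sum τ₁ τ₂)
  | cases {Γ : Env L} {pc : L} {e e₁ e₂ : Expr L} {x y : Var} {τ₁ τ₂ τ : Ty L} :
      Typed P Γ pc e (.sum τ₁ τ₂) → Typed P (Γ.cons x τ₁) pc e₁ τ →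
      Typed P (Γ.cons y τ₂) pc e₂ τ → Typed P Γ pc (.cases e x e₁ y e₂) τ
  | lam {Γ : Env L} {pc₁ pc₂ : L} {x : Var} {e : Expr L} {τ₁ τ₂ : Ty L} :
      Typed P (Γ.cons x τ₁) pc₁ e τ₂ → Typed P Γ pc₂ (.lam x τ₁ e) (.arrow τ₁ pc₁ τ₂)
  | app {Γ : Env L} {pc₁ pc₂ : L} {f e : Expr L} {τ₁ τ₂ : Ty L} :
      Typed P Γ pc₁ f (.arrow τ₁ pc₂ τ₂) → Typed P Γ pc₁ e τ₁ → pc₁ ≤ pc₂ →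
      Typed P Γ pc₁ (.app f e) τ₂
  | label {Γ : Env L} {pc ℓ : L} {e : Expr L} {τ : Ty L} :
      Typed P Γ pc e τ → Typed P Γ pc (.label ℓ e) (.lab ℓ τ)
  | unlabel {Γ : Env L} {pc ℓ : L} {e₁ e₂ : Expr L} {x : Var} {τ₁ τ₂ : Ty L} :
      Typed P Γ pc e₁ (.lab ℓ τ₁) → Typed P (Γ.cons x τ₁) (pc ⊔ ℓ) e₂ τ₂ →
      Protects ℓ τ₂ → Typed P Γ pc (.unlabel e₁ x e₂) τ₂
  | read {Γ : Env L} {pc : L} : Typed P Γ pc .read P.σ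
  | write {Γ : Env L} {pc : L} {e : Expr L} :
      Typed P Γ pc e P.σ → pc ≤ P.lState → Typed P Γ pc (.write e) .unit
  | throw {Γ : Env L} {pc : L} {τ : Ty L} : pc ≤ P.lExn → Typed P Γ pc .throw τ
  | tryCatch {Γ : Env L} {pc : L} {e₁ e₂ : Expr L} {τ : Ty L} :
      Typed P Γ pc e₁ τ → Typed P Γ pc e₂ τ → Protects P.lExn τ →
      Typed P Γ pc (.tryCatch e₁ e₂) τ

theorem Typed.mono {Γ : Env L} {pc pc' : L} {e : Expr L} {τ : Ty L} (h : Typed P Γ pc e τ)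
    (hle : pc' ≤ pc) : Typed P Γ pc' e τ := by
  induction h generalizing pc' with
  | var h => exact .var h
  | unit => exact .unit
  | pair _ _ ih₁ ih₂ => exact .pair (ih₁ hle) (ih₂ hle)
  | fst _ ih => exact .fst (ih hle)
  | snd _ ih => exact .snd (ih hle)
  | inl _ ih => exact .inl (ih hle)
  | inr _ ih => exact .inr (ih hle)
  | cases _ _ _ ih ih₁ ih₂ => exact .cases (ih hle) (ih₁ hle) (ih₂ hle)
  | lam h _ => exact .lam h
  | app _ _ h ih₁ ih₂ => exact .app (ih₁ hle) (ih₂ hle) (hle.trans h)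
  | label _ ih => exact .label (ih hle)
  | unlabel _ _ h ih₁ ih₂ => exact .unlabel (ih₁ hle) (ih₂ (sup_mono_left _ hle)) h
  | read => exact .read
  | write _ h ih => exact .write (ih hle) (hle.trans h)
  | throw h => exact .throw (hle.trans h)
  | tryCatch _ _ h ih₁ ih₂ => exact .tryCatch (ih₁ hle) (ih₂ hle) h

theorem HasType.typed {Γ : Env L} {pc : L} {e : Expr L} {τ : Ty L} (h : HasType P Γ pc e τ) :
    Typed P Γ pc e τ := by
  induction h with
  | var h => exact .var h
  | unit => exact .unit
  | pair _ _ ih₁ ih₂ => exact .pair ih₁ ih₂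
  | fst _ ih => exact .fst ih
  | snd _ ih => exact .snd ih
  | inl _ ih => exact .inl ih
  | inr _ ih => exact .inr ih
  | cases _ _ _ ih ih₁ ih₂ => exact .cases ih ih₁ ih₂
  | lam _ ih => exact .lam ih
  | app _ _ h ih₁ ih₂ => exact .app ih₁ ih₂ h
  | label _ ih => exact .label ih
  | unlabel _ _ h ih₁ ih₂ => exact .unlabel ih₁ ih₂ h
  | variance _ h ih => exact ih.mono h
  | read => exact .read
  | write _ h ih => exact .write ih h
  | throw h => exact .throw h
  | tryCatch _ _ h ih₁ ih₂ => exact .tryCatch ih₁ ih₂ h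

/-- Values have no effects, so the program counter of their typing is arbitrary. -/
theorem Typed.of_isValue {Γ : Env L} {pc : L} {v : Expr L} {τ : Ty L} (h : Typed P Γ pc v τ)
    (hv : IsValue v) (pc' : L) : Typed P Γ pc' v τ := by
  induction hv generalizing τ with
  | unit => cases h; exact .unit
  | inl _ ih => cases h with | inl h => exact .inl (ih h)
  | inr _ ih => cases h with | inr h => exact .inr (ih h)
  | pair _ _ ih₁ ih₂ => cases h with | pair h₁ h₂ => exact .pair (ih₁ h₁) (ih₂ h₂)
  | lam => cases h with | lam h => exact .lam h
  | label _ _ ih => cases h with | label h => exact .label (ih h)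

theorem Typed.weaken {Γ Δ : Env L} {pc : L} {e : Expr L} {τ : Ty L} (h : Typed P Γ pc e τ)
    (hΔ : ∀ x t, Γ x = some t → Δ x = some t) : Typed P Δ pc e τ := by
  induction h generalizing Δ with
  | var h => exact .var (hΔ _ _ h)
  | unit => exact .unit
  | pair _ _ ih₁ ih₂ => exact .pair (ih₁ hΔ) (ih₂ hΔ)
  | fst _ ih => exact .fst (ih hΔ)
  | snd _ ih => exact .snd (ih hΔ)
  | inl _ ih => exact .inl (ih hΔ)
  | inr _ ih => exact .inr (ih hΔ)
  | cases _ _ _ ih ih₁ ih₂ =>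
    exact .cases (ih hΔ) (ih₁ (Env.cons_mono hΔ _ _)) (ih₂ (Env.cons_mono hΔ _ _))
  | lam _ ih => exact .lam (ih (Env.cons_mono hΔ _ _))
  | app _ _ h ih₁ ih₂ => exact .app (ih₁ hΔ) (ih₂ hΔ) h
  | label _ ih => exact .label (ih hΔ)
  | unlabel _ _ h ih₁ ih₂ => exact .unlabel (ih₁ hΔ) (ih₂ (Env.cons_mono hΔ _ _)) h
  | read => exact .read
  | write _ h ih => exact .write (ih hΔ) h
  | throw h => exact .throw h
  | tryCatch _ _ h ih₁ ih₂ => exact .tryCatch (ih₁ hΔ) (ih₂ hΔ) h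

theorem Typed.weaken_empty {Γ : Env L} {pc : L} {e : Expr L} {τ : Ty L}
    (h : Typed P Env.empty pc e τ) : Typed P Γ pc e τ :=
  h.weaken fun _ _ hx => nomatch hx

/-- The premise for an expression under a binder `y`, which may shadow the substituted variable. -/
theorem Typed.under_binder {Γ : Env L} {pc : L} {e v : Expr L} {x y : Var} {τ τx τy : Ty L}
    (h : Typed P ((Γ.cons x τx).cons y τy) pc e τ)
    (ih : y ≠ x → Typed P (Γ.cons y τy) pc (e.subst x v) τ) :
    Typed P (Γ.cons y τy) pc (if y = x then e else e.subst x v) τ := by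
  split_ifs with hyx
  · subst hyx
    rwa [Env.cons_idem] at h
  · exact ih hyx

theorem Typed.subst {Γ : Env L} {pc : L} {e v : Expr L} {x : Var} {τ τx : Ty L}
    (h : Typed P (Γ.cons x τx) pc e τ) (hv : Typed P Env.empty ⊤ v τx) :
    Typed P Γ pc (e.subst x v) τ := by
  generalize hΔ : Γ.cons x τx = Δ at h
  induction h generalizing Γ with
  | @var _ pc y τ h =>
    subst hΔ
    simp only [Expr.subst]
    split_ifs with hyx
    · subst hyx
      obtain rfl : τx = τ := by simpa [Env.cons] using h
      exact (hv.mono le_top).weaken_empty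
    · exact .var (by simpa [Env.cons, hyx] using h)
  | unit => exact .unit
  | pair _ _ ih₁ ih₂ => exact .pair (ih₁ hΔ) (ih₂ hΔ)
  | fst _ ih => exact .fst (ih hΔ)
  | snd _ ih => exact .snd (ih hΔ)
  | inl _ ih => exact .inl (ih hΔ)
  | inr _ ih => exact .inr (ih hΔ)
  | cases _ h₁ h₂ ih ih₁ ih₂ =>
    subst hΔ
    exact .cases (ih rfl) (h₁.under_binder fun hyx => ih₁ (Env.cons_comm _ hyx _ _).symm)
      (h₂.under_binder fun hyx => ih₂ (Env.cons_comm _ hyx _ _).symm)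
  | lam h₁ ih =>
    subst hΔ
    exact .lam (h₁.under_binder fun hyx => ih (Env.cons_comm _ hyx _ _).symm)
  | app _ _ h ih₁ ih₂ => exact .app (ih₁ hΔ) (ih₂ hΔ) h
  | label _ ih => exact .label (ih hΔ)
  | unlabel _ h₂ h ih₁ ih₂ =>
    subst hΔ
    exact .unlabel (ih₁ rfl) (h₂.under_binder fun hyx => ih₂ (Env.cons_comm _ hyx _ _).symm) h
  | read => exact .read
  | write _ h ih => exact .write (ih hΔ) h
  | throw h => exact .throw h
  | tryCatch _ _ h ih₁ ih₂ => exact .tryCatch (ih₁ hΔ) (ih₂ hΔ) h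

/-! ### Type preservation and confinement of effects -/

/-- What typing at `τ` under `pc` guarantees of an evaluation from the state `s` to the outcome `r` and
the state `s'`. Values and states are closed and typed under `⊤`, hence under every label. -/
structure OutcomeTyped (P : Params L) (pc : L) (s : Expr L) (τ : Ty L) (r : Outcome L)
    (s' : Expr L) : Prop where
  val : ∀ v, r = .val v → Typed P Env.empty ⊤ v τ
  throw : r = .throw → pc ≤ P.lExn
  state : Typed P Env.empty ⊤ s' P.σ
  write : s' = s ∨ pc ≤ P.lState

theorem Eval.outcomeTyped {e s s' : Expr L} {r : Outcome L} (h : Eval e s r s') {pc : L}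
    {τ : Ty L} (he : Typed P Env.empty pc e τ) (hs : Typed P Env.empty ⊤ s P.σ) :
    OutcomeTyped P pc s τ r s' := by
  induction h generalizing pc τ with
  | unit => cases he; exact ⟨by rintro _ ⟨⟩; exact .unit, nofun, hs, .inl rfl⟩
  | lam => cases he with | lam he => exact ⟨by rintro _ ⟨⟩; exact .lam he, nofun, hs, .inl rfl⟩
  | app _ _ _ ih₁ ih₂ ih₃ =>
    cases he with
    | app hf ha hle =>
      have h₁ := ih₁ hf hs
      have h₂ := ih₂ ha h₁.state
      cases h₁.val _ rfl with
      | lam hb =>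
        have h₃ := ih₃ (hb.subst (h₂.val _ rfl)) h₂.state
        exact ⟨h₃.val, fun h => hle.trans (h₃.throw h), h₃.state, by
          have := h₁.write; have := h₂.write; have := h₃.write; grind⟩
  | appThrowL _ ih =>
    cases he with
    | app hf _ _ =>
      have h₁ := ih hf hs
      exact ⟨nofun, fun _ => h₁.throw rfl, h₁.state, h₁.write⟩
  | appThrowR _ _ ih₁ ih₂ =>
    cases he with
    | app hf ha _ =>
      have h₁ := ih₁ hf hs
      have h₂ := ih₂ ha h₁.state
      exact ⟨nofun, fun _ => h₂.throw rfl, h₂.state, by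
        have := h₁.write; have := h₂.write; grind⟩
  | pair _ _ ih₁ ih₂ =>
    cases he with
    | pair hf ha =>
      have h₁ := ih₁ hf hs
      have h₂ := ih₂ ha h₁.state
      refine ⟨?_, nofun, h₂.state, by have := h₁.write; have := h₂.write; grind⟩
      rintro _ ⟨⟩
      exact .pair (h₁.val _ rfl) (h₂.val _ rfl)
  | pairThrowL _ ih =>
    cases he with
    | pair hf _ =>
      have h₁ := ih hf hs
      exact ⟨nofun, fun _ => h₁.throw rfl, h₁.state, h₁.write⟩
  | pairThrowR _ _ ih₁ ih₂ =>
    cases he with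
    | pair hf ha =>
      have h₁ := ih₁ hf hs
      have h₂ := ih₂ ha h₁.state
      exact ⟨nofun, fun _ => h₂.throw rfl, h₂.state, by
        have := h₁.write; have := h₂.write; grind⟩
  | fst _ ih =>
    cases he with
    | fst he =>
      have h₁ := ih he hs
      refine ⟨?_, nofun, h₁.state, h₁.write⟩
      rintro _ ⟨⟩
      cases h₁.val _ rfl
      assumption
  | snd _ ih =>
    cases he with
    | snd he =>
      have h₁ := ih he hs
      refine ⟨?_, nofun, h₁.state, h₁.write⟩
      rintro _ ⟨⟩
      cases h₁.val _ rfl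
      assumption
  | inl _ ih =>
    cases he with
    | inl he =>
      have h₁ := ih he hs
      exact ⟨by rintro _ ⟨⟩; exact .inl (h₁.val _ rfl), nofun, h₁.state, h₁.write⟩
  | inr _ ih =>
    cases he with
    | inr he =>
      have h₁ := ih he hs
      exact ⟨by rintro _ ⟨⟩; exact .inr (h₁.val _ rfl), nofun, h₁.state, h₁.write⟩
  | label _ ih =>
    cases he with
    | label he =>
      have h₁ := ih he hs
      exact ⟨by rintro _ ⟨⟩; exact .label (h₁.val _ rfl), nofun, h₁.state, h₁.write⟩
  | fstThrow _ ih | sndThrow _ ih | inlThrow _ ih | inrThrow _ ih | casesThrow _ ih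
  | labelThrow _ ih | unlabelThrow _ ih | writeThrow _ ih =>
    cases he
    have h₁ := ih ‹_› hs
    exact ⟨nofun, fun _ => h₁.throw rfl, h₁.state, h₁.write⟩
  | casesInl _ _ ih ih₁ =>
    cases he with
    | cases he he₁ he₂ =>
      have h := ih he hs
      cases h.val _ rfl with
      | inl hv =>
        have h₁ := ih₁ (he₁.subst hv) h.state
        exact ⟨h₁.val, h₁.throw, h₁.state, by have := h.write; have := h₁.write; grind⟩
  | casesInr _ _ ih ih₁ =>
    cases he with
    | cases he he₁ he₂ =>
      have h := ih he hs
      cases h.val _ rfl with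
      | inr hv =>
        have h₁ := ih₁ (he₂.subst hv) h.state
        exact ⟨h₁.val, h₁.throw, h₁.state, by have := h.write; have := h₁.write; grind⟩
  | unlabel _ _ ih₁ ih₂ =>
    cases he with
    | unlabel he₁ he₂ hp =>
      have h₁ := ih₁ he₁ hs
      cases h₁.val _ rfl with
      | label hv =>
        have h₂ := ih₂ (he₂.subst hv) h₁.state
        refine ⟨h₂.val, fun h => (LabelOrder.le_sup_left _ _).trans (h₂.throw h), h₂.state, ?_⟩
        have h₁w := h₁.write
        have h₂w := h₂.write.imp_right (LabelOrder.le_sup_left _ _).trans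
        grind
  | read => cases he; exact ⟨by rintro _ ⟨⟩; exact hs, nofun, hs, .inl rfl⟩
  | write _ ih =>
    cases he with
    | write he hle =>
      have h₁ := ih he hs
      exact ⟨by rintro _ ⟨⟩; exact .unit, nofun, h₁.val _ rfl, .inr hle⟩
  | throw => cases he with | throw hle => exact ⟨nofun, fun _ => hle, hs, .inl rfl⟩
  | tryValue _ ih =>
    cases he with
    | tryCatch he₁ he₂ _ =>
      have h₁ := ih he₁ hs
      exact ⟨h₁.val, nofun, h₁.state, h₁.write⟩
  | tryThrow _ _ ih₁ ih₂ =>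
    cases he with
    | tryCatch he₁ he₂ _ =>
      have h₁ := ih₁ he₁ hs
      have h₂ := ih₂ he₂ h₁.state
      exact ⟨h₂.val, h₂.throw, h₂.state, by have := h₁.write; have := h₂.write; grind⟩


/-! ### Low equivalence -/

/-- `e₁` and `e₂` are hidden from an attacker at `A`: they have a common typing at a type `τ'` that
protects a label `h` and under a program counter `pc'` above `h`, where `h` does not flow to `A`. They are used at `τ` under
`pc`, and these need not protect anything. -/
inductive Hidden (P : Params L) (A : L) (Γ : Env L) (pc : L) (e₁ e₂ : Expr L) (τ : Ty L) :
    Prop where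
  | intro {h pc' : L} {τ' : Ty L} : ¬ h ≤ A → h ≤ pc' → Protects h τ' →
      Typed P Γ pc' e₁ τ' → Typed P Γ pc' e₂ τ' → Typed P Γ pc e₁ τ → Typed P Γ pc e₂ τ →
      Hidden P A Γ pc e₁ e₂ τ

/-- Low equivalence at `A`: two expressions that are built by the same typing rules up to subexpressions
hidden from `A`. Like `Typed`, it has no variance rule; see `Rel.mono`. -/
inductive Rel (P : Params L) (A : L) : Env L → L → Expr L → Expr L → Ty L → Prop where
  | hidden {Γ : Env L} {pc : L} {e e' : Expr L} {τ : Ty L} : Hidden P A Γ pc e e' τ →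
      Rel P A Γ pc e e' τ
  | var {Γ : Env L} {pc : L} {x : Var} {τ : Ty L} : Γ x = some τ →
      Rel P A Γ pc (.var x) (.var x) τ
  | unit {Γ : Env L} {pc : L} : Rel P A Γ pc .unit .unit .unit
  | pair {Γ : Env L} {pc : L} {e₁ e₂ e₁' e₂' : Expr L} {τ₁ τ₂ : Ty L} :
      Rel P A Γ pc e₁ e₁' τ₁ → Rel P A Γ pc e₂ e₂' τ₂ →
      Rel P A Γ pc (.pair e₁ e₂) (.pair e₁' e₂') (.prod τ₁ τ₂)
  | fst {Γ : Env L} {pc : L} {e e' : Expr L} {τ₁ τ₂ : Ty L} :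
      Rel P A Γ pc e e' (.prod τ₁ τ₂) → Rel P A Γ pc (.fst e) (.fst e') τ₁
  | snd {Γ : Env L} {pc : L} {e e' : Expr L} {τ₁ τ₂ : Ty L} :
      Rel P A Γ pc e e' (.prod τ₁ τ₂) → Rel P A Γ pc (.snd e) (.snd e') τ₂
  | inl {Γ : Env L} {pc : L} {e e' : Expr L} {τ₁ τ₂ : Ty L} :
      Rel P A Γ pc e e' τ₁ → Rel P A Γ pc (.inl e) (.inl e') (.sum τ₁ τ₂)
  | inr {Γ : Env L} {pc : L} {e e' : Expr L} {τ₁ τ₂ : Ty L} :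
      Rel P A Γ pc e e' τ₂ → Rel P A Γ pc (.inr e) (.inr e') (.sum τ₁ τ₂)
  | cases {Γ : Env L} {pc : L} {e e₁ e₂ e' e₁' e₂' : Expr L} {x y : Var} {τ₁ τ₂ τ : Ty L} :
      Rel P A Γ pc e e' (.sum τ₁ τ₂) → Rel P A (Γ.cons x τ₁) pc e₁ e₁' τ →
      Rel P A (Γ.cons y τ₂) pc e₂ e₂' τ →
      Rel P A Γ pc (.cases e x e₁ y e₂) (.cases e' x e₁' y e₂') τ
  | lam {Γ : Env L} {pc₁ pc₂ : L} {x : Var} {e e' : Expr L} {τ₁ τ₂ : Ty L} :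
      Rel P A (Γ.cons x τ₁) pc₁ e e' τ₂ →
      Rel P A Γ pc₂ (.lam x τ₁ e) (.lam x τ₁ e') (.arrow τ₁ pc₁ τ₂)
  | app {Γ : Env L} {pc₁ pc₂ : L} {f e f' e' : Expr L} {τ₁ τ₂ : Ty L} :
      Rel P A Γ pc₁ f f' (.arrow τ₁ pc₂ τ₂) → Rel P A Γ pc₁ e e' τ₁ → pc₁ ≤ pc₂ →
      Rel P A Γ pc₁ (.app f e) (.app f' e') τ₂
  | label {Γ : Env L} {pc ℓ : L} {e e' : Expr L} {τ : Ty L} :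
      Rel P A Γ pc e e' τ → Rel P A Γ pc (.label ℓ e) (.label ℓ e') (.lab ℓ τ)
  | unlabel {Γ : Env L} {pc ℓ : L} {e₁ e₂ e₁' e₂' : Expr L} {x : Var} {τ₁ τ₂ : Ty L} :
      Rel P A Γ pc e₁ e₁' (.lab ℓ τ₁) → Rel P A (Γ.cons x τ₁) (pc ⊔ ℓ) e₂ e₂' τ₂ →
      Protects ℓ τ₂ → Rel P A Γ pc (.unlabel e₁ x e₂) (.unlabel e₁' x e₂') τ₂
  | read {Γ : Env L} {pc : L} : Rel P A Γ pc .read .read P.σ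
  | write {Γ : Env L} {pc : L} {e e' : Expr L} :
      Rel P A Γ pc e e' P.σ → pc ≤ P.lState → Rel P A Γ pc (.write e) (.write e') .unit
  | throw {Γ : Env L} {pc : L} {τ : Ty L} : pc ≤ P.lExn → Rel P A Γ pc .throw .throw τ
  | tryCatch {Γ : Env L} {pc : L} {e₁ e₂ e₁' e₂' : Expr L} {τ : Ty L} :
      Rel P A Γ pc e₁ e₁' τ → Rel P A Γ pc e₂ e₂' τ → Protects P.lExn τ →
      Rel P A Γ pc (.tryCatch e₁ e₂) (.tryCatch e₁' e₂') τ

theorem Typed.rel {Γ : Env L} {pc : L} {e : Expr L} {τ : Ty L} (h : Typed P Γ pc e τ) :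
    Rel P A Γ pc e e τ := by
  induction h with
  | var h => exact .var h
  | unit => exact .unit
  | pair _ _ ih₁ ih₂ => exact .pair ih₁ ih₂
  | fst _ ih => exact .fst ih
  | snd _ ih => exact .snd ih
  | inl _ ih => exact .inl ih
  | inr _ ih => exact .inr ih
  | cases _ _ _ ih ih₁ ih₂ => exact .cases ih ih₁ ih₂
  | lam _ ih => exact .lam ih
  | app _ _ h ih₁ ih₂ => exact .app ih₁ ih₂ h
  | label _ ih => exact .label ih
  | unlabel _ _ h ih₁ ih₂ => exact .unlabel ih₁ ih₂ h
  | read => exact .read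
  | write _ h ih => exact .write ih h
  | throw h => exact .throw h
  | tryCatch _ _ h ih₁ ih₂ => exact .tryCatch ih₁ ih₂ h

theorem HasType.rel {Γ : Env L} {pc : L} {e : Expr L} {τ : Ty L} (h : HasType P Γ pc e τ) :
    Rel P A Γ pc e e τ :=
  h.typed.rel

theorem Rel.left {Γ : Env L} {pc : L} {e e' : Expr L} {τ : Ty L} (h : Rel P A Γ pc e e' τ) :
    Typed P Γ pc e τ := by
  induction h with
  | hidden h => cases h; assumption
  | var h => exact .var h
  | unit => exact .unit
  | pair _ _ ih₁ ih₂ => exact .pair ih₁ ih₂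
  | fst _ ih => exact .fst ih
  | snd _ ih => exact .snd ih
  | inl _ ih => exact .inl ih
  | inr _ ih => exact .inr ih
  | cases _ _ _ ih ih₁ ih₂ => exact .cases ih ih₁ ih₂
  | lam _ ih => exact .lam ih
  | app _ _ h ih₁ ih₂ => exact .app ih₁ ih₂ h
  | label _ ih => exact .label ih
  | unlabel _ _ h ih₁ ih₂ => exact .unlabel ih₁ ih₂ h
  | read => exact .read
  | write _ h ih => exact .write ih h
  | throw h => exact .throw h
  | tryCatch _ _ h ih₁ ih₂ => exact .tryCatch ih₁ ih₂ h

theorem Rel.symm {Γ : Env L} {pc : L} {e e' : Expr L} {τ : Ty L} (h : Rel P A Γ pc e e' τ) :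
    Rel P A Γ pc e' e τ := by
  induction h with
  | hidden h =>
    obtain ⟨hA, hle, hp, h₁, h₂, h₃, h₄⟩ := h
    exact .hidden ⟨hA, hle, hp, h₂, h₁, h₄, h₃⟩
  | var h => exact .var h
  | unit => exact .unit
  | pair _ _ ih₁ ih₂ => exact .pair ih₁ ih₂
  | fst _ ih => exact .fst ih
  | snd _ ih => exact .snd ih
  | inl _ ih => exact .inl ih
  | inr _ ih => exact .inr ih
  | cases _ _ _ ih ih₁ ih₂ => exact .cases ih ih₁ ih₂
  | lam _ ih => exact .lam ih
  | app _ _ h ih₁ ih₂ => exact .app ih₁ ih₂ h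
  | label _ ih => exact .label ih
  | unlabel _ _ h ih₁ ih₂ => exact .unlabel ih₁ ih₂ h
  | read => exact .read
  | write _ h ih => exact .write ih h
  | throw h => exact .throw h
  | tryCatch _ _ h ih₁ ih₂ => exact .tryCatch ih₁ ih₂ h

theorem Rel.right {Γ : Env L} {pc : L} {e e' : Expr L} {τ : Ty L} (h : Rel P A Γ pc e e' τ) :
    Typed P Γ pc e' τ :=
  h.symm.left

theorem Rel.mono {Γ : Env L} {pc pc' : L} {e e' : Expr L} {τ : Ty L} (h : Rel P A Γ pc e e' τ)
    (hle : pc' ≤ pc) : Rel P A Γ pc' e e' τ := by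
  induction h generalizing pc' with
  | hidden h =>
    obtain ⟨hA, h, hp, h₁, h₂, h₃, h₄⟩ := h
    exact .hidden ⟨hA, h, hp, h₁, h₂, h₃.mono hle, h₄.mono hle⟩
  | var h => exact .var h
  | unit => exact .unit
  | pair _ _ ih₁ ih₂ => exact .pair (ih₁ hle) (ih₂ hle)
  | fst _ ih => exact .fst (ih hle)
  | snd _ ih => exact .snd (ih hle)
  | inl _ ih => exact .inl (ih hle)
  | inr _ ih => exact .inr (ih hle)
  | cases _ _ _ ih ih₁ ih₂ => exact .cases (ih hle) (ih₁ hle) (ih₂ hle)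
  | lam h _ => exact .lam h
  | app _ _ h ih₁ ih₂ => exact .app (ih₁ hle) (ih₂ hle) (hle.trans h)
  | label _ ih => exact .label (ih hle)
  | unlabel _ _ h ih₁ ih₂ => exact .unlabel (ih₁ hle) (ih₂ (sup_mono_left _ hle)) h
  | read => exact .read
  | write _ h ih => exact .write (ih hle) (hle.trans h)
  | throw h => exact .throw (hle.trans h)
  | tryCatch _ _ h ih₁ ih₂ => exact .tryCatch (ih₁ hle) (ih₂ hle) h

theorem Rel.weaken {Γ Δ : Env L} {pc : L} {e e' : Expr L} {τ : Ty L} (h : Rel P A Γ pc e e' τ)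
    (hΔ : ∀ x t, Γ x = some t → Δ x = some t) : Rel P A Δ pc e e' τ := by
  induction h generalizing Δ with
  | hidden h =>
    obtain ⟨hA, h, hp, h₁, h₂, h₃, h₄⟩ := h
    exact .hidden ⟨hA, h, hp, h₁.weaken hΔ, h₂.weaken hΔ, h₃.weaken hΔ, h₄.weaken hΔ⟩
  | var h => exact .var (hΔ _ _ h)
  | unit => exact .unit
  | pair _ _ ih₁ ih₂ => exact .pair (ih₁ hΔ) (ih₂ hΔ)
  | fst _ ih => exact .fst (ih hΔ)
  | snd _ ih => exact .snd (ih hΔ)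
  | inl _ ih => exact .inl (ih hΔ)
  | inr _ ih => exact .inr (ih hΔ)
  | cases _ _ _ ih ih₁ ih₂ =>
    exact .cases (ih hΔ) (ih₁ (Env.cons_mono hΔ _ _)) (ih₂ (Env.cons_mono hΔ _ _))
  | lam _ ih => exact .lam (ih (Env.cons_mono hΔ _ _))
  | app _ _ h ih₁ ih₂ => exact .app (ih₁ hΔ) (ih₂ hΔ) h
  | label _ ih => exact .label (ih hΔ)
  | unlabel _ _ h ih₁ ih₂ => exact .unlabel (ih₁ hΔ) (ih₂ (Env.cons_mono hΔ _ _)) h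
  | read => exact .read
  | write _ h ih => exact .write (ih hΔ) h
  | throw h => exact .throw h
  | tryCatch _ _ h ih₁ ih₂ => exact .tryCatch (ih₁ hΔ) (ih₂ hΔ) h

/-- The premise for expressions under a binder `y`, which may shadow the substituted variable. -/
theorem Rel.under_binder {Γ : Env L} {pc : L} {e e' v v' : Expr L} {x y : Var} {τ τx τy : Ty L}
    (h : Rel P A ((Γ.cons x τx).cons y τy) pc e e' τ)
    (ih : y ≠ x → Rel P A (Γ.cons y τy) pc (e.subst x v) (e'.subst x v') τ) :
    Rel P A (Γ.cons y τy) pc (if y = x then e else e.subst x v)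
      (if y = x then e' else e'.subst x v') τ := by
  split_ifs with hyx
  · subst hyx
    rwa [Env.cons_idem] at h
  · exact ih hyx

theorem Rel.subst {Γ : Env L} {pc : L} {e e' v v' : Expr L} {x : Var} {τ τx : Ty L}
    (h : Rel P A (Γ.cons x τx) pc e e' τ) (hv : Rel P A Env.empty ⊤ v v' τx) :
    Rel P A Γ pc (e.subst x v) (e'.subst x v') τ := by
  generalize hΔ : Γ.cons x τx = Δ at h
  induction h generalizing Γ with
  | hidden h =>
    subst hΔ
    obtain ⟨hA, h, hp, h₁, h₂, h₃, h₄⟩ := h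
    exact .hidden ⟨hA, h, hp, h₁.subst hv.left, h₂.subst hv.right, h₃.subst hv.left,
      h₄.subst hv.right⟩
  | @var _ pc y τ h =>
    subst hΔ
    simp only [Expr.subst]
    split_ifs with hyx
    · subst hyx
      obtain rfl : τx = τ := by simpa [Env.cons] using h
      exact (hv.mono le_top).weaken fun _ _ hx => nomatch hx
    · exact .var (by simpa [Env.cons, hyx] using h)
  | unit => exact .unit
  | pair _ _ ih₁ ih₂ => exact .pair (ih₁ hΔ) (ih₂ hΔ)
  | fst _ ih => exact .fst (ih hΔ)
  | snd _ ih => exact .snd (ih hΔ)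
  | inl _ ih => exact .inl (ih hΔ)
  | inr _ ih => exact .inr (ih hΔ)
  | cases _ h₁ h₂ ih ih₁ ih₂ =>
    subst hΔ
    exact .cases (ih rfl) (h₁.under_binder fun hyx => ih₁ (Env.cons_comm _ hyx _ _).symm)
      (h₂.under_binder fun hyx => ih₂ (Env.cons_comm _ hyx _ _).symm)
  | lam h₁ ih =>
    subst hΔ
    exact .lam (h₁.under_binder fun hyx => ih (Env.cons_comm _ hyx _ _).symm)
  | app _ _ h ih₁ ih₂ => exact .app (ih₁ hΔ) (ih₂ hΔ) h
  | label _ ih => exact .label (ih hΔ)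
  | unlabel _ h₂ h ih₁ ih₂ =>
    subst hΔ
    exact .unlabel (ih₁ rfl) (h₂.under_binder fun hyx => ih₂ (Env.cons_comm _ hyx _ _).symm) h
  | read => exact .read
  | write _ h ih => exact .write (ih hΔ) h
  | throw h => exact .throw h
  | tryCatch _ _ h ih₁ ih₂ => exact .tryCatch (ih₁ hΔ) (ih₂ hΔ) h

/-! ### Low equivalence of values -/

theorem Rel.pair_inv {Γ : Env L} {pc : L} {v₁ v₂ w₁ w₂ : Expr L} {τ₁ τ₂ : Ty L}
    (h : Rel P A Γ pc (.pair v₁ v₂) (.pair w₁ w₂) (.prod τ₁ τ₂)) :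
    Rel P A Γ pc v₁ w₁ τ₁ ∧ Rel P A Γ pc v₂ w₂ τ₂ := by
  cases h with
  | pair h₁ h₂ => exact ⟨h₁, h₂⟩
  | hidden h =>
    obtain ⟨hA, hle, hp, h₁, h₂, h₃, h₄⟩ := h
    cases h₁ with | pair a₁ b₁ =>
    cases h₂ with | pair a₂ b₂ =>
    cases h₃ with | pair a₃ b₃ =>
    cases h₄ with | pair a₄ b₄ =>
    cases hp with | prod hp₁ hp₂ =>
    exact ⟨.hidden ⟨hA, hle, hp₁, a₁, a₂, a₃, a₄⟩, .hidden ⟨hA, hle, hp₂, b₁, b₂, b₃, b₄⟩⟩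

/-- Sum types protect no label, so injections are never hidden. -/
theorem Rel.inl_inv {Γ : Env L} {pc : L} {v w : Expr L} {τ₁ τ₂ : Ty L}
    (h : Rel P A Γ pc (.inl v) w (.sum τ₁ τ₂)) : ∃ v', w = .inl v' ∧ Rel P A Γ pc v v' τ₁ := by
  cases h with
  | inl h => exact ⟨_, rfl, h⟩
  | hidden h =>
    obtain ⟨_, _, hp, h₁, _, _, _⟩ := h
    cases h₁
    nomatch hp

theorem Rel.inr_inv {Γ : Env L} {pc : L} {v w : Expr L} {τ₁ τ₂ : Ty L}
    (h : Rel P A Γ pc (.inr v) w (.sum τ₁ τ₂)) : ∃ v', w = .inr v' ∧ Rel P A Γ pc v v' τ₂ := by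
  cases h with
  | inr h => exact ⟨_, rfl, h⟩
  | hidden h =>
    obtain ⟨_, _, hp, h₁, _, _, _⟩ := h
    cases h₁
    nomatch hp

theorem Rel.label_inv {Γ : Env L} {pc ℓ ℓ₁ ℓ₂ : L} {v w : Expr L} {τ : Ty L}
    (h : Rel P A Γ pc (.label ℓ₁ v) (.label ℓ₂ w) (.lab ℓ τ)) :
    ℓ₁ = ℓ ∧ ℓ₂ = ℓ ∧ (ℓ ≤ A → Rel P A Γ pc v w τ) := by
  cases h with
  | label h => exact ⟨rfl, rfl, fun _ => h⟩
  | hidden h =>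
    obtain ⟨hA, hle, hp, h₁, h₂, h₃, h₄⟩ := h
    cases h₁ with | label h₁ =>
    cases h₂ with | label h₂ =>
    cases h₃ with | label h₃ =>
    cases h₄ with | label h₄ =>
    refine ⟨rfl, rfl, fun hℓ => ?_⟩
    cases hp with
    | lab_le h => exact absurd (h.trans hℓ) hA
    | lab_inner hp => exact .hidden ⟨hA, hle, hp, h₁, h₂, h₃, h₄⟩

/-- Function bodies applied to low equivalent arguments are low equivalent. Hidden functions have hidden
bodies: a function type that protects `h` has its latent label above `h` and its result type
protecting `h`. The bound variables may differ in this case. -/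
theorem Rel.beta {Γ : Env L} {pc q : L} {x y : Var} {b c v w : Expr L} {σ₁ σ₂ τ₁ τ₂ : Ty L}
    (h : Rel P A Γ q (.lam x σ₁ b) (.lam y σ₂ c) (.arrow τ₁ pc τ₂))
    (hv : Rel P A Env.empty ⊤ v w τ₁) : Rel P A Γ pc (b.subst x v) (c.subst y w) τ₂ := by
  cases h with
  | lam h => exact h.subst hv
  | hidden h =>
    obtain ⟨hA, hle, hp, h₁, h₂, h₃, h₄⟩ := h
    cases h₁ with | lam h₁ =>
    cases h₂ with | lam h₂ =>
    cases h₃ with | lam h₃ =>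
    cases h₄ with | lam h₄ =>
    cases hp with | arrow hp hle' =>
    exact .hidden ⟨hA, hle', hp, h₁.subst hv.left, h₂.subst hv.right, h₃.subst hv.left,
      h₄.subst hv.right⟩

/-- If `A` sees the label `ℓ`, the contents are low equivalent. Otherwise nothing relates them, but the
bodies are run under `pc ⊔ ℓ` at a type that protects `ℓ`, and are thus hidden. -/
theorem Rel.unlabel_body {pc ℓ ℓ₁ ℓ₂ : L} {x : Var} {b c v w : Expr L} {τ₁ τ₂ : Ty L}
    (h : Rel P A Env.empty ⊤ (.label ℓ₁ v) (.label ℓ₂ w) (.lab ℓ τ₁))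
    (hb : Rel P A (Env.empty.cons x τ₁) (pc ⊔ ℓ) b c τ₂) (hp : Protects ℓ τ₂) :
    Rel P A Env.empty (pc ⊔ ℓ) (b.subst x v) (c.subst x w) τ₂ := by
  by_cases hℓ : ℓ ≤ A
  · exact hb.subst (h.label_inv.2.2 hℓ)
  · cases h.left with | label hv =>
    cases h.right with | label hw =>
    exact .hidden ⟨hℓ, LabelOrder.le_sup_right _ _, hp, hb.left.subst hv, hb.right.subst hw,
      hb.left.subst hv, hb.right.subst hw⟩

/-! ### Evaluation preserves low equivalence -/

/-- Low equivalence of outcomes; an exception is only equivalent to an exception. -/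
inductive Outcome.Rel (P : Params L) (A : L) (τ : Ty L) : Outcome L → Outcome L → Prop where
  | val {v w : Expr L} : DCC.Rel P A Env.empty ⊤ v w τ → Outcome.Rel P A τ (.val v) (.val w)
  | throw : Outcome.Rel P A τ .throw .throw

/-- Hidden code does not throw, leaves a visible state unchanged, and yields hidden results. Both
typings are preserved: the protecting one keeps the results hidden, the other one types them at `τ`. -/
theorem Hidden.eval {pc : L} {e₁ e₂ s₁ s₂ s₁' s₂' : Expr L} {τ : Ty L} {r₁ r₂ : Outcome L}
    (hσ : Protects P.lState P.σ) (hExn : P.lExn ≤ A) (h : Hidden P A Env.empty pc e₁ e₂ τ)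
    (hs : Rel P A Env.empty ⊤ s₁ s₂ P.σ) (hev₁ : Eval e₁ s₁ r₁ s₁') (hev₂ : Eval e₂ s₂ r₂ s₂') :
    Outcome.Rel P A τ r₁ r₂ ∧ Rel P A Env.empty ⊤ s₁' s₂' P.σ := by
  obtain ⟨hA, hle, hp, h₁, h₂, h₃, h₄⟩ := h
  have o₁ := hev₁.outcomeTyped h₁ hs.left
  have o₂ := hev₂.outcomeTyped h₂ hs.right
  have o₃ := hev₁.outcomeTyped h₃ hs.left
  have o₄ := hev₂.outcomeTyped h₄ hs.right
  constructor
  · cases r₁ with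
    | throw => exact absurd (hle.trans ((o₁.throw rfl).trans hExn)) hA
    | val v₁ =>
      cases r₂ with
      | throw => exact absurd (hle.trans ((o₂.throw rfl).trans hExn)) hA
      | val v₂ =>
        exact .val (.hidden ⟨hA, le_top, hp, o₁.val _ rfl, o₂.val _ rfl, o₃.val _ rfl,
          o₄.val _ rfl⟩)
  · by_cases hState : P.lState ≤ A
    · rw [o₁.write.resolve_right fun hq => hA (hle.trans (hq.trans hState)),
        o₂.write.resolve_right fun hq => hA (hle.trans (hq.trans hState))]
      exact hs
    -- The state type protects `lState`, so all states are hidden from `A`.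
    · exact .hidden ⟨hState, le_top, hσ, o₁.state, o₂.state, o₁.state, o₂.state⟩

/-- Evaluation preserves low equivalence if exceptions are visible. -/
theorem Rel.eval {pc : L} {e₁ e₂ s₁ s₂ s₁' s₂' : Expr L} {τ : Ty L} {r₁ r₂ : Outcome L}
    (hσ : Protects P.lState P.σ) (hExn : P.lExn ≤ A) (h : Rel P A Env.empty pc e₁ e₂ τ)
    (hs : Rel P A Env.empty ⊤ s₁ s₂ P.σ) (hev₁ : Eval e₁ s₁ r₁ s₁') (hev₂ : Eval e₂ s₂ r₂ s₂') :
    Outcome.Rel P A τ r₁ r₂ ∧ Rel P A Env.empty ⊤ s₁' s₂' P.σ := by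
  induction hev₁ generalizing pc e₂ s₂ s₂' τ r₂ with
  | unit =>
    cases h with
    | hidden h => exact h.eval hσ hExn hs .unit hev₂
    | unit => cases hev₂; exact ⟨.val .unit, hs⟩
  | lam =>
    cases h with
    | hidden h => exact h.eval hσ hExn hs .lam hev₂
    | lam h => cases hev₂; exact ⟨.val (.lam h), hs⟩
  | app ev₁ ev₂ ev₃ ih₁ ih₂ ih₃ =>
    cases h with
    | hidden h => exact h.eval hσ hExn hs (.app ev₁ ev₂ ev₃) hev₂
    | app hf ha hle =>
      cases hev₂ with
      | appThrowL ev₁' => exact nomatch (ih₁ hf hs ev₁').1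
      | appThrowR ev₁' ev₂' => exact nomatch (ih₂ ha (ih₁ hf hs ev₁').2 ev₂').1
      | app ev₁' ev₂' ev₃' =>
        obtain ⟨⟨hv⟩, hs₁⟩ := ih₁ hf hs ev₁'
        obtain ⟨⟨hw⟩, hs₂⟩ := ih₂ ha hs₁ ev₂'
        exact ih₃ (hv.beta hw) hs₂ ev₃'
  | appThrowL ev₁ ih₁ =>
    cases h with
    | hidden h => exact h.eval hσ hExn hs (.appThrowL ev₁) hev₂
    | app hf ha hle =>
      cases hev₂ with
      | appThrowL ev₁' => exact ⟨.throw, (ih₁ hf hs ev₁').2⟩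
      | appThrowR ev₁' _ => exact nomatch (ih₁ hf hs ev₁').1
      | app ev₁' _ _ => exact nomatch (ih₁ hf hs ev₁').1
  | appThrowR ev₁ ev₂ ih₁ ih₂ =>
    cases h with
    | hidden h => exact h.eval hσ hExn hs (.appThrowR ev₁ ev₂) hev₂
    | app hf ha hle =>
      cases hev₂ with
      | appThrowL ev₁' => exact nomatch (ih₁ hf hs ev₁').1
      | appThrowR ev₁' ev₂' => exact ⟨.throw, (ih₂ ha (ih₁ hf hs ev₁').2 ev₂').2⟩
      | app ev₁' ev₂' _ => exact nomatch (ih₂ ha (ih₁ hf hs ev₁').2 ev₂').1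
  | pair ev₁ ev₂ ih₁ ih₂ =>
    cases h with
    | hidden h => exact h.eval hσ hExn hs (.pair ev₁ ev₂) hev₂
    | pair hf ha =>
      cases hev₂ with
      | pairThrowL ev₁' => exact nomatch (ih₁ hf hs ev₁').1
      | pairThrowR ev₁' ev₂' => exact nomatch (ih₂ ha (ih₁ hf hs ev₁').2 ev₂').1
      | pair ev₁' ev₂' =>
        obtain ⟨⟨hv⟩, hs₁⟩ := ih₁ hf hs ev₁'
        obtain ⟨⟨hw⟩, hs₂⟩ := ih₂ ha hs₁ ev₂'
        exact ⟨.val (.pair hv hw), hs₂⟩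
  | pairThrowL ev₁ ih₁ =>
    cases h with
    | hidden h => exact h.eval hσ hExn hs (.pairThrowL ev₁) hev₂
    | pair hf ha =>
      cases hev₂ with
      | pairThrowL ev₁' => exact ⟨.throw, (ih₁ hf hs ev₁').2⟩
      | pairThrowR ev₁' _ => exact nomatch (ih₁ hf hs ev₁').1
      | pair ev₁' _ => exact nomatch (ih₁ hf hs ev₁').1
  | pairThrowR ev₁ ev₂ ih₁ ih₂ =>
    cases h with
    | hidden h => exact h.eval hσ hExn hs (.pairThrowR ev₁ ev₂) hev₂
    | pair hf ha =>
      cases hev₂ with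
      | pairThrowL ev₁' => exact nomatch (ih₁ hf hs ev₁').1
      | pairThrowR ev₁' ev₂' => exact ⟨.throw, (ih₂ ha (ih₁ hf hs ev₁').2 ev₂').2⟩
      | pair ev₁' ev₂' => exact nomatch (ih₂ ha (ih₁ hf hs ev₁').2 ev₂').1
  | fst ev ih =>
    cases h with
    | hidden h => exact h.eval hσ hExn hs (.fst ev) hev₂
    | fst h =>
      cases hev₂ with
      | fstThrow ev' => exact nomatch (ih h hs ev').1
      | fst ev' =>
        obtain ⟨⟨hv⟩, hs'⟩ := ih h hs ev'
        exact ⟨.val hv.pair_inv.1, hs'⟩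
  | fstThrow ev ih =>
    cases h with
    | hidden h => exact h.eval hσ hExn hs (.fstThrow ev) hev₂
    | fst h =>
      cases hev₂ with
      | fstThrow ev' => exact ⟨.throw, (ih h hs ev').2⟩
      | fst ev' => exact nomatch (ih h hs ev').1
  | snd ev ih =>
    cases h with
    | hidden h => exact h.eval hσ hExn hs (.snd ev) hev₂
    | snd h =>
      cases hev₂ with
      | sndThrow ev' => exact nomatch (ih h hs ev').1
      | snd ev' =>
        obtain ⟨⟨hv⟩, hs'⟩ := ih h hs ev'
        exact ⟨.val hv.pair_inv.2, hs'⟩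
  | sndThrow ev ih =>
    cases h with
    | hidden h => exact h.eval hσ hExn hs (.sndThrow ev) hev₂
    | snd h =>
      cases hev₂ with
      | sndThrow ev' => exact ⟨.throw, (ih h hs ev').2⟩
      | snd ev' => exact nomatch (ih h hs ev').1
  | inl ev ih =>
    cases h with
    | hidden h => exact h.eval hσ hExn hs (.inl ev) hev₂
    | inl h =>
      cases hev₂ with
      | inlThrow ev' => exact nomatch (ih h hs ev').1
      | inl ev' =>
        obtain ⟨⟨hv⟩, hs'⟩ := ih h hs ev'
        exact ⟨.val (.inl hv), hs'⟩
  | inlThrow ev ih =>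
    cases h with
    | hidden h => exact h.eval hσ hExn hs (.inlThrow ev) hev₂
    | inl h =>
      cases hev₂ with
      | inlThrow ev' => exact ⟨.throw, (ih h hs ev').2⟩
      | inl ev' => exact nomatch (ih h hs ev').1
  | inr ev ih =>
    cases h with
    | hidden h => exact h.eval hσ hExn hs (.inr ev) hev₂
    | inr h =>
      cases hev₂ with
      | inrThrow ev' => exact nomatch (ih h hs ev').1
      | inr ev' =>
        obtain ⟨⟨hv⟩, hs'⟩ := ih h hs ev'
        exact ⟨.val (.inr hv), hs'⟩
  | inrThrow ev ih =>
    cases h with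
    | hidden h => exact h.eval hσ hExn hs (.inrThrow ev) hev₂
    | inr h =>
      cases hev₂ with
      | inrThrow ev' => exact ⟨.throw, (ih h hs ev').2⟩
      | inr ev' => exact nomatch (ih h hs ev').1
  | label ev ih =>
    cases h with
    | hidden h => exact h.eval hσ hExn hs (.label ev) hev₂
    | label h =>
      cases hev₂ with
      | labelThrow ev' => exact nomatch (ih h hs ev').1
      | label ev' =>
        obtain ⟨⟨hv⟩, hs'⟩ := ih h hs ev'
        exact ⟨.val (.label hv), hs'⟩
  | labelThrow ev ih =>
    cases h with
    | hidden h => exact h.eval hσ hExn hs (.labelThrow ev) hev₂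
    | label h =>
      cases hev₂ with
      | labelThrow ev' => exact ⟨.throw, (ih h hs ev').2⟩
      | label ev' => exact nomatch (ih h hs ev').1
  | casesInl ev ev₁ ih ih₁ =>
    cases h with
    | hidden h => exact h.eval hσ hExn hs (.casesInl ev ev₁) hev₂
    | cases h h₁ h₂ =>
      cases hev₂ with
      | casesThrow ev' => exact nomatch (ih h hs ev').1
      | casesInr ev' _ =>
        obtain ⟨⟨hv⟩, _⟩ := ih h hs ev'
        obtain ⟨_, ⟨⟩, _⟩ := hv.inl_inv
      | casesInl ev' ev₁' =>
        obtain ⟨⟨hv⟩, hs'⟩ := ih h hs ev'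
        obtain ⟨_, ⟨⟩, hv⟩ := hv.inl_inv
        exact ih₁ (h₁.subst hv) hs' ev₁'
  | casesInr ev ev₁ ih ih₁ =>
    cases h with
    | hidden h => exact h.eval hσ hExn hs (.casesInr ev ev₁) hev₂
    | cases h h₁ h₂ =>
      cases hev₂ with
      | casesThrow ev' => exact nomatch (ih h hs ev').1
      | casesInl ev' _ =>
        obtain ⟨⟨hv⟩, _⟩ := ih h hs ev'
        obtain ⟨_, ⟨⟩, _⟩ := hv.inr_inv
      | casesInr ev' ev₁' =>
        obtain ⟨⟨hv⟩, hs'⟩ := ih h hs ev'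
        obtain ⟨_, ⟨⟩, hv⟩ := hv.inr_inv
        exact ih₁ (h₂.subst hv) hs' ev₁'
  | casesThrow ev ih =>
    cases h with
    | hidden h => exact h.eval hσ hExn hs (.casesThrow ev) hev₂
    | cases h _ _ =>
      cases hev₂ with
      | casesThrow ev' => exact ⟨.throw, (ih h hs ev').2⟩
      | casesInl ev' _ => exact nomatch (ih h hs ev').1
      | casesInr ev' _ => exact nomatch (ih h hs ev').1
  | unlabel ev₁ ev₂ ih₁ ih₂ =>
    cases h with
    | hidden h => exact h.eval hσ hExn hs (.unlabel ev₁ ev₂) hev₂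
    | unlabel h₁ h₂ hp =>
      cases hev₂ with
      | unlabelThrow ev₁' => exact nomatch (ih₁ h₁ hs ev₁').1
      | unlabel ev₁' ev₂' =>
        obtain ⟨⟨hv⟩, hs'⟩ := ih₁ h₁ hs ev₁'
        exact ih₂ (hv.unlabel_body h₂ hp) hs' ev₂'
  | unlabelThrow ev ih =>
    cases h with
    | hidden h => exact h.eval hσ hExn hs (.unlabelThrow ev) hev₂
    | unlabel h _ _ =>
      cases hev₂ with
      | unlabelThrow ev' => exact ⟨.throw, (ih h hs ev').2⟩
      | unlabel ev' _ => exact nomatch (ih h hs ev').1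
  | read =>
    cases h with
    | hidden h => exact h.eval hσ hExn hs .read hev₂
    | read => cases hev₂; exact ⟨.val hs, hs⟩
  | write ev ih =>
    cases h with
    | hidden h => exact h.eval hσ hExn hs (.write ev) hev₂
    | write h _ =>
      cases hev₂ with
      | writeThrow ev' => exact nomatch (ih h hs ev').1
      | write ev' =>
        obtain ⟨⟨hv⟩, _⟩ := ih h hs ev'
        exact ⟨.val .unit, hv⟩
  | writeThrow ev ih =>
    cases h with
    | hidden h => exact h.eval hσ hExn hs (.writeThrow ev) hev₂
    | write h _ =>
      cases hev₂ with
      | writeThrow ev' => exact ⟨.throw, (ih h hs ev').2⟩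
      | write ev' => exact nomatch (ih h hs ev').1
  | throw =>
    cases h with
    | hidden h => exact h.eval hσ hExn hs .throw hev₂
    | throw _ => cases hev₂; exact ⟨.throw, hs⟩
  | tryValue ev ih =>
    cases h with
    | hidden h => exact h.eval hσ hExn hs (.tryValue ev) hev₂
    | tryCatch h _ _ =>
      cases hev₂ with
      | tryValue ev' => exact ih h hs ev'
      | tryThrow ev' _ => exact nomatch (ih h hs ev').1
  | tryThrow ev₁ ev₂ ih₁ ih₂ =>
    cases h with
    | hidden h => exact h.eval hσ hExn hs (.tryThrow ev₁ ev₂) hev₂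
    | tryCatch h₁ h₂ _ =>
      cases hev₂ with
      | tryValue ev₁' => exact nomatch (ih₁ h₁ hs ev₁').1
      | tryThrow ev₁' ev₂' => exact ih₂ h₂ (ih₁ h₁ hs ev₁').2 ev₂'

/-! ### Observations of the attacker -/

theorem CtxHasType.rel {Γ Δ : Env L} {q q' : L} {τ τ' : Ty L} {C : Ctx L} {e₁ e₂ : Expr L}
    (hC : CtxHasType P Γ q τ Δ q' C τ') (h : Hidden P A Γ q e₁ e₂ τ) :
    Rel P A Δ q' (C.plug e₁) (C.plug e₂) τ' := by
  induction hC with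
  | hole hΔ => exact (Rel.hidden h).weaken hΔ
  | pairL _ h ih => exact .pair ih h.rel
  | pairR h _ ih => exact .pair h.rel ih
  | fst _ ih => exact .fst ih
  | snd _ ih => exact .snd ih
  | inl _ ih => exact .inl ih
  | inr _ ih => exact .inr ih
  | casesScrut _ h₁ h₂ ih => exact .cases ih h₁.rel h₂.rel
  | casesInl h _ h₂ ih => exact .cases h.rel ih h₂.rel
  | casesInr h h₁ _ ih => exact .cases h.rel h₁.rel ih
  | lam _ ih => exact .lam ih
  | appL _ h hle ih => exact .app ih h.rel hle
  | appR h _ hle ih => exact .app h.rel ih hle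
  | label _ ih => exact .label ih
  | unlabelL _ h hp ih => exact .unlabel ih h.rel hp
  | unlabelR h _ hp ih => exact .unlabel h.rel ih hp
  | variance _ hle ih => exact ih.mono hle
  | write _ hle ih => exact .write ih hle
  | tryL _ h hp ih => exact .tryCatch ih h.rel hp
  | catchR h _ hp ih => exact .tryCatch h.rel ih hp

/-- If a value has a first-order type `τ` with all labels visible at `A`, then every other type `τ'` of
it protects only labels that flow to `A`: the labels in `τ'` that wrap parts of the value are those written
in the value, hence occur in `τ`. -/
theorem Protects.le_of_visibleAt {h pc q : L} {v : Expr L} {τ' τ : Ty L} {Γ : Env L}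
    (hp : Protects h τ') (hv : IsValue v) (h₁ : Typed P Γ pc v τ') (h₂ : Typed P Γ q v τ)
    (hτ : τ.FirstOrder) (hvis : τ.VisibleAt A) : h ≤ A := by
  induction hp generalizing v τ with
  | lab_le hle =>
    cases hv <;> cases h₁
    cases h₂
    exact hle.trans hvis.1
  | lab_inner _ ih =>
    cases hv with
    | label _ hv =>
      cases h₁ with | label h₁ =>
      cases h₂ with | label h₂ =>
      exact ih hv h₁ h₂ hτ hvis.2
    | _ => cases h₁
  | prod _ _ ih _ =>
    cases hv with
    | pair hv _ =>
      cases h₁ with | pair h₁ _ =>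
      cases h₂ with | pair h₂ _ =>
      exact ih hv h₁ h₂ hτ.1 hvis.1
    | _ => cases h₁
  | arrow =>
    cases hv <;> cases h₁
    cases h₂
    exact hτ.elim

theorem Rel.eq_of_visibleAt {Γ : Env L} {pc : L} {v w : Expr L} {τ : Ty L}
    (h : Rel P A Γ pc v w τ) (hv : IsValue v) (hτ : τ.FirstOrder) (hvis : τ.VisibleAt A) :
    v = w := by
  have key : ∀ {v w τ}, Hidden P A Γ pc v w τ → IsValue v → τ.FirstOrder → τ.VisibleAt A →
      v = w := by
    rintro v w τ ⟨hA, _, hp, h₁, _, h₃, _⟩ hv hτ hvis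
    exact absurd (hp.le_of_visibleAt hv h₁ h₃ hτ hvis) hA
  induction hv generalizing w τ with
  | unit =>
    cases h with
    | unit => rfl
    | hidden h => exact key h .unit hτ hvis
  | inl hv ih =>
    cases h with
    | inl h => rw [ih h hτ.1 hvis.1]
    | hidden h => exact key h hv.inl hτ hvis
  | inr hv ih =>
    cases h with
    | inr h => rw [ih h hτ.2 hvis.2]
    | hidden h => exact key h hv.inr hτ hvis
  | pair hv₁ hv₂ ih₁ ih₂ =>
    cases h with
    | pair h₁ h₂ => rw [ih₁ h₁ hτ.1 hvis.1, ih₂ h₂ hτ.2 hvis.2]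
    | hidden h => exact key h (hv₁.pair hv₂) hτ hvis
  | lam =>
    cases h with
    | lam h => exact hτ.elim
    | hidden h => exact key h (.lam _ _ _) hτ hvis
  | label ℓ hv ih =>
    cases h with
    | label h => rw [ih h hτ hvis.2]
    | hidden h => exact key h (hv.label _) hτ hvis

theorem Ty.VisibleAt.mono {k k' : L} {τ : Ty L} (h : τ.VisibleAt k) (hle : k ≤ k') :
    τ.VisibleAt k' := by
  induction τ with
  | unit => trivial
  | sum _ _ ih₁ ih₂ => exact ⟨ih₁ h.1, ih₂ h.2⟩
  | prod _ _ ih₁ ih₂ => exact ⟨ih₁ h.1, ih₂ h.2⟩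
  | arrow _ _ _ ih₁ ih₂ => exact ⟨ih₁ h.1, h.2.1.trans hle, ih₂ h.2.2⟩
  | lab _ _ ih => exact ⟨h.1.trans hle, ih h.2⟩

/-- Noninterference for any program counter `pc₀` of the programs: if `A` sees the state, then either
programs under `pc₀` cannot write, or equivalent states are equal. -/
theorem stExnEquiv_of_protects (hσ : P.σ.FirstOrder) (hσState : Protects P.lState P.σ)
    (hflow : P.lExn ≤ P.lState) {Γ : Env L} {pc pc₀ ℓ : L} {τ : Ty L} {e₁ e₂ : Expr L}
    (h₁ : HasType P Γ pc e₁ τ) (h₂ : HasType P Γ pc e₂ τ) (hτ : Protects ℓ τ) (hpc : ℓ ≤ pc)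
    (hA : ¬ ℓ ≤ A) (hst : P.lState ≤ A → ¬ pc₀ ≤ P.lState ∨ P.σ.VisibleAt A) :
    StExnEquiv P Γ pc₀ A e₁ e₂ := by
  intro s C q τ' v₁ v₂ s₁ s₂ hs hsσ hq₁ hq₂ hC hv₁ hv₂ hst₁ hst₂
  have hrel : Rel P A Env.empty pc₀ (C.plug e₁) (C.plug e₂) _ :=
    hC.rel ⟨hA, hpc, hτ, h₁.typed, h₂.typed, hq₁.typed, hq₂.typed⟩
  have hsσ := hsσ.typed.of_isValue hs ⊤
  have hev₁ := hst₁.eval hs hv₁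
  have hev₂ := hst₂.eval hs hv₂
  constructor
  · intro hExn
    cases (hrel.eval hσState hExn hsσ.rel hev₁ hev₂).1 with
    | val hv =>
      exact hv.eq_of_visibleAt hv₁ ⟨trivial, trivial⟩ ⟨le_rfl, trivial, trivial⟩
  · intro hState
    rcases hst hState with hpc₀ | hvis
    · rw [(hev₁.outcomeTyped hrel.left hsσ).write.resolve_right hpc₀,
        (hev₂.outcomeTyped hrel.right hsσ).write.resolve_right hpc₀]
    · exact (hrel.eval hσState (hflow.trans hState) hsσ.rel hev₁ hev₂).2.eq_of_visibleAt
        (hev₁.isValue hs).1 hσ hvis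

end DCC

theorem theorem3p1 {L : Type*} [LabelOrder L] (P : DCC.Params L)
    (hσ : P.σ.FirstOrder) (hσState : DCC.Protects P.lState P.σ) (hflow : P.lExn ≤ P.lState)
    (Γ : DCC.Env L) (pc ℓ : L) (τ : DCC.Ty L) (e₁ e₂ : DCC.Expr L)
    (h₁ : DCC.HasType P Γ pc e₁ τ) (h₂ : DCC.HasType P Γ pc e₂ τ)
    (hτ : DCC.Protects ℓ τ) (hpc : ℓ ≤ pc) :
    ∀ ℓAtk : L, ℓ ≤ ℓAtk ∨
      (DCC.StExnEquiv P Γ pc ℓAtk e₁ e₂ ∧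
        (P.σ.VisibleAt P.lState → ∀ pc₀ : L, DCC.StExnEquiv P Γ pc₀ ℓAtk e₁ e₂)) := by
  intro A
  refine or_iff_not_imp_left.2 fun hA => ⟨?_, fun hvis pc₀ => ?_⟩
  · exact DCC.stExnEquiv_of_protects hσ hσState hflow h₁ h₂ hτ hpc hA fun hState =>
      .inl fun hle => hA (hpc.trans (hle.trans hState))
  · exact DCC.stExnEquiv_of_protects hσ hσState hflow h₁ h₂ hτ hpc hA fun hState =>
      .inr (hvis.mono hState)
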